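/- **Definitions.** A Riesz space is *Dedekind complete* if every non-empty subset that is bounded above has a supremum, and *universally complete* if, in addition, every non-empty subset consisting of mutually disjoint elements ($|x|\wedge|y|=0$) has a supremum. An element $e\ge 0$ is a *weak order unit* if $e\wedge|x|=0$ implies $x=0$. A *universal completion* $E^u$ of $E$ is a universally complete Riesz space containing $E$ as an order dense Riesz subspace. A *conditional expectation operator* on a Dedekind complete Riesz space $E$ with weak order unit is a positive order continuous linear projection $T:E\to E$ whose range $R(T)$ is a Dedekind complete Riesz subspace of $E$ and which maps weak order units to weak order units. $T$ is *strictly positive* if $T|f|=0$ implies $f=0$. For strictly positive $T$, the *natural domain* of $T$ is $$L^1(T)=\{v-w : v,w\in D\}\subseteq E^u,$$ where $D$ is the set of all suprema in $E^u$ of non-empty upwards directed sets $A\subseteq E_+$ for which $T(A)$ is order bounded in $E^u$. The space $E$ is *$T$-universally complete* if $T$ is strictly positive and $E=L^1(T)$. In that case $$L^\infty(T)=\{f\in L^1(T) : |f|\le g \text{ for some } g\in R(T)_+\}.$$ An *$f$-algebra* with unit $e$ is a Riesz space with an associative bilinear multiplication with unit $e$ such that products of positive elements are positive, and such that $a\wedge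 b=0$ and $c\ge 0$ imply $(ca)\wedge b=(ac)\wedge b=0$. **Theorem 2.2.** Let $E$ be a Dedekind complete Riesz space, $E^u$ a universal completion of $E$, $T$ a conditional expectation operator on $E$ such that $E$ is $T$-universally complete, and $e$ a weak order unit of $E$ with $Te=e$. Then: 1. $R(T)$ is universally complete. 2. There is an $f$-algebra multiplication on $E^u$ with unit $e$, and, for every such multiplication, $fg\in R(T)$ for all $f,g\in R(T)$; with this multiplication $R(T)$ is an $f$-algebra with unit $e$. 3. For every such multiplication on $E^u$, $gf\in E=L^1(T)$ for all $g\in R(T)$, $f\in L^1(T)$, and $gf\in L^\infty(T)$ for all $g\in R(T)$, $f\in L^\infty(T)$; in this way $E=L^1(T)$ and $L^\infty(T)$ are (unital) $R(T)$-modules. -/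

import Mathlib

namespace RieszCE

/-!  A (real) Riesz space is a real vector space `E` with a lattice order compatible with the vector
space structure, that is, `[AddCommGroup E] [Lattice E] [IsOrderedAddMonoid E] [Module ℝ E]
[IsOrderedModule ℝ E]`. -/

/-- Every nonempty set that is bounded above has a supremum. -/
def IsDedekindComplete (X : Type*) [Preorder X] : Prop :=
  ∀ S : Set X, S.Nonempty → BddAbove S → ∃ s, IsLUB S s

/-- `x ⊥ y`. -/
def AreDisjoint {E : Type*} [AddCommGroup E] [Lattice E] (x y : E) : Prop :=
  |x| ⊓ |y| = 0

/-- Dedekind complete, and every (nonempty) set of mutually disjoint elements has a supremum. -/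
def IsUniversallyComplete (E : Type*) [AddCommGroup E] [Lattice E] : Prop :=
  IsDedekindComplete E ∧
    ∀ S : Set E, S.Nonempty → S.Pairwise AreDisjoint → ∃ s, IsLUB S s

/-- `e` is a weak order unit: `e ≥ 0` and only `0` is disjoint from `e`. -/
def IsWeakOrderUnit {E : Type*} [AddCommGroup E] [Lattice E] (e : E) : Prop :=
  0 ≤ e ∧ ∀ x : E, e ⊓ |x| = 0 → x = 0

/-- A universal completion of `E`: a universally complete Riesz space `U` together with an
embedding `ι` of `E` onto an order dense Riesz subspace of `U`. -/
structure IsUniversalCompletion {E U : Type*} [AddCommGroup E] [Lattice E] [Module ℝ E]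
    [AddCommGroup U] [Lattice U] [Module ℝ U] (ι : E →ₗ[ℝ] U) : Prop where
  injective : Function.Injective ι
  map_sup : ∀ x y : E, ι (x ⊔ y) = ι x ⊔ ι y
  orderDense : ∀ u : U, 0 < u → ∃ x : E, 0 < ι x ∧ ι x ≤ u
  universallyComplete : IsUniversallyComplete U

/-- A Riesz subspace: a linear subspace that is a sublattice. -/
structure RieszSubspace (E : Type*) [AddCommGroup E] [Lattice E] [Module ℝ E] extends
    Submodule ℝ E where
  sup_mem' : ∀ {x y : E}, x ∈ carrier → y ∈ carrier → x ⊔ y ∈ carrier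

section

variable {E : Type*} [AddCommGroup E] [Lattice E] [IsOrderedAddMonoid E] [Module ℝ E]

theorem RieszSubspace.inf_mem (K : RieszSubspace E) {x y : E}
    (hx : x ∈ K.toSubmodule) (hy : y ∈ K.toSubmodule) : x ⊓ y ∈ K.toSubmodule := by
  have h : x ⊓ y = x + y - (x ⊔ y) := by
    rw [← inf_add_sup x y, add_sub_cancel_right]
  rw [h]
  exact K.toSubmodule.sub_mem (K.toSubmodule.add_mem hx hy) (K.sup_mem' hx hy)

/-- A Riesz subspace carries the order and the lattice operations of the ambient space. -/
instance RieszSubspace.instLattice (K : RieszSubspace E) : Lattice K.toSubmodule :=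
  Subtype.lattice (fun _ _ hx hy => K.sup_mem' hx hy) (fun _ _ hx hy => K.inf_mem hx hy)

instance RieszSubspace.instIsOrderedAddMonoid (K : RieszSubspace E) :
    IsOrderedAddMonoid K.toSubmodule where
  add_le_add_left a b h c := add_le_add_left (show (a : E) ≤ (b : E) from h) (c : E)

instance RieszSubspace.instPosSMulMono [IsOrderedModule ℝ E] (K : RieszSubspace E) :
    PosSMulMono ℝ K.toSubmodule :=
  ⟨fun r hr a b h => show r • (a : E) ≤ r • (b : E) from
    smul_le_smul_of_nonneg_left (show (a : E) ≤ (b : E) from h) hr⟩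

instance RieszSubspace.instSMulPosMono [IsOrderedModule ℝ E] (K : RieszSubspace E) :
    SMulPosMono ℝ K.toSubmodule :=
  ⟨fun a ha r s h => show r • (a : E) ≤ s • (a : E) from
    smul_le_smul_of_nonneg_right h (show (0 : E) ≤ (a : E) from ha)⟩

instance RieszSubspace.instIsOrderedModule [IsOrderedModule ℝ E] (K : RieszSubspace E) :
    IsOrderedModule ℝ K.toSubmodule where

end

/-- Conditional expectation operators on a Dedekind complete Riesz space with weak order unit:
positive order continuous linear projections whose range is a Dedekind complete Riesz subspace and
which map weak order units to weak order units. -/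
structure IsConditionalExpectation {E : Type*} [AddCommGroup E] [Lattice E] [Module ℝ E]
    (T : E →ₗ[ℝ] E) : Prop where
  projection : ∀ x, T (T x) = T x
  positive : ∀ x, 0 ≤ x → 0 ≤ T x
  orderContinuous : ∀ A : Set E, A.Nonempty → DirectedOn (· ≥ ·) A → IsGLB A 0 →
    IsGLB (T '' A) 0
  range_sup_mem : ∀ {x y : E}, x ∈ LinearMap.range T → y ∈ LinearMap.range T →
    x ⊔ y ∈ LinearMap.range T
  range_dedekindComplete : IsDedekindComplete {x : E // x ∈ LinearMap.range T}
  map_weakOrderUnit : ∀ w, IsWeakOrderUnit w → IsWeakOrderUnit (T w)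

/-- `T` is strictly positive: `T |f| = 0` implies `f = 0`. -/
def IsStrictlyPositive {E : Type*} [AddCommGroup E] [Lattice E] [Module ℝ E]
    (T : E →ₗ[ℝ] E) : Prop :=
  ∀ f, T |f| = 0 → f = 0

/-- The range `R(T)` of a conditional expectation operator, as a Riesz subspace. -/
def IsConditionalExpectation.R {E : Type*} [AddCommGroup E] [Lattice E] [Module ℝ E]
    {T : E →ₗ[ℝ] E} (hT : IsConditionalExpectation T) : RieszSubspace E where
  toSubmodule := LinearMap.range T
  sup_mem' := hT.range_sup_mem

/-- The positive part of the natural domain of `T` in the universal completion `U`: suprema `u` in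
`U` of upwards directed sets in `E₊` whose image under `T` is order bounded in `U`. -/
def naturalDomainPos {E U : Type*} [AddCommGroup E] [Lattice E] [Module ℝ E]
    [AddCommGroup U] [Lattice U] [Module ℝ U] (ι : E →ₗ[ℝ] U) (T : E →ₗ[ℝ] E) : Set U :=
  {u | ∃ A : Set E, A.Nonempty ∧ DirectedOn (· ≤ ·) A ∧ (∀ a ∈ A, 0 ≤ a) ∧
    BddAbove ((fun a => ι (T a)) '' A) ∧ IsLUB (ι '' A) u}

/-- The natural domain `L¹(T) = dom(T)` of `T`, as a subset of the universal completion `U`. -/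
def L1 {E U : Type*} [AddCommGroup E] [Lattice E] [Module ℝ E]
    [AddCommGroup U] [Lattice U] [Module ℝ U] (ι : E →ₗ[ℝ] U) (T : E →ₗ[ℝ] E) : Set U :=
  {u | ∃ v ∈ naturalDomainPos ι T, ∃ w ∈ naturalDomainPos ι T, u = v - w}

/-- `E` is `T`-universally complete: `T` is strictly positive (so that it has a natural domain)
and `E = L¹(T)` inside the universal completion. -/
def IsTUniversallyComplete {E U : Type*} [AddCommGroup E] [Lattice E] [Module ℝ E]
    [AddCommGroup U] [Lattice U] [Module ℝ U] (ι : E →ₗ[ℝ] U) (T : E →ₗ[ℝ] E) : Prop :=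
  IsStrictlyPositive T ∧ L1 ι T = Set.range ι

/-- `L^∞(T)`, the elements `f` with `|f| ≤ g` for some `g ∈ R(T)₊`, where `L¹(T) = E`. -/
def LInfty {E : Type*} [AddCommGroup E] [Lattice E] [IsOrderedAddMonoid E] [Module ℝ E]
    [IsOrderedModule ℝ E] {T : E →ₗ[ℝ] E} (hT : IsConditionalExpectation T) : Submodule ℝ E where
  carrier := {f | ∃ g ∈ hT.R.toSubmodule, 0 ≤ g ∧ |f| ≤ g}
  zero_mem' := ⟨0, hT.R.toSubmodule.zero_mem, le_rfl, by simp⟩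
  add_mem' := by
    rintro a b ⟨g, hg, hg0, hag⟩ ⟨h, hh, hh0, hbh⟩
    exact ⟨g + h, hT.R.toSubmodule.add_mem hg hh, add_nonneg hg0 hh0,
      (abs_add_le a b).trans (add_le_add hag hbh)⟩
  smul_mem' := by
    rintro c a ⟨g, hg, hg0, hag⟩
    have h1 : |a| ≤ g := hag
    have h2 : a ≤ g := (le_abs_self a).trans h1
    have h3 : -a ≤ g := (neg_le_abs a).trans h1
    refine ⟨|c| • g, hT.R.toSubmodule.smul_mem _ hg, smul_nonneg (abs_nonneg c) hg0, ?_⟩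
    rcases abs_cases c with ⟨hc, hc0⟩ | ⟨hc, hc0⟩
    · rw [hc]
      refine abs_le'.2 ⟨smul_le_smul_of_nonneg_left h2 hc0, ?_⟩
      rw [← smul_neg]
      exact smul_le_smul_of_nonneg_left h3 hc0
    · rw [hc]
      have hc1 : 0 ≤ -c := by linarith
      refine abs_le'.2 ⟨?_, ?_⟩
      · have := smul_le_smul_of_nonneg_left h3 hc1
        simpa using this
      · have := smul_le_smul_of_nonneg_left h2 hc1
        simpa using this

/-- `m` makes the Riesz space `A` an `f`-algebra with multiplicative unit `e`: `m` is an
associative bilinear product with unit `e`, products of positive elements are positive, and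
`a ⊓ b = 0`, `c ≥ 0` imply `(c a) ⊓ b = 0 = (a c) ⊓ b`. -/
structure IsFAlgebraProduct {A : Type*} [AddCommGroup A] [Lattice A] [Module ℝ A]
    (m : A →ₗ[ℝ] A →ₗ[ℝ] A) (e : A) : Prop where
  assoc : ∀ a b c, m (m a b) c = m a (m b c)
  one_mul : ∀ a, m e a = a
  mul_one : ∀ a, m a e = a
  nonneg : ∀ a b, 0 ≤ a → 0 ≤ b → 0 ≤ m a b
  disjoint_left : ∀ a b c, a ⊓ b = 0 → 0 ≤ c → m c a ⊓ b = 0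
  disjoint_right : ∀ a b c, a ⊓ b = 0 → 0 ≤ c → m a c ⊓ b = 0

/-- The bilinear action `act` makes the vector space `M` a (unital, left) module over the algebra
`R` with product `m` and unit `e`. -/
structure IsModuleAction {R M : Type*} [AddCommGroup R] [Module ℝ R] [AddCommGroup M] [Module ℝ M]
    (m : R →ₗ[ℝ] R →ₗ[ℝ] R) (e : R) (act : R →ₗ[ℝ] M →ₗ[ℝ] M) : Prop where
  one_act : ∀ x, act e x = x
  mul_act : ∀ g h x, act (m g h) x = act g (act h x)

end RieszCE

/-! Calculus in `U` is reduced to real arithmetic. `LeOn d x y` says that `x ≤ y` up to an error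
disjoint from `d`. A point is a maximal filter of positive elements, and near a point an element
that is locally bounded by multiples of the weak unit has a real value (`HasVal`). Values may be
infinite, but every positive element has a point below it at which finitely many given elements are
finite (`exists_point_hasVal`). Hence identities and inequalities may be checked at such points
(`eq_of_hasVal`, `le_of_hasVal`).

The square of `a` is the supremum over real `t` of `2ta - t²e`. It exists because universal
completeness turns local bounds into global ones (`bddAbove_of_locally_bounded`). Polarization gives
a product computed pointwise. Conversely every `f`-algebra product with unit `e` is computed
pointwise (`IsFAlgebraProduct.hasVal`), so the product is unique.

Since `E = L¹(T)`, a positive supremum in `U` of elements of `R(T)` belongs to `E`, and order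
continuity makes `T` fix it (`exists_mem_R_of_isLUB`). This gives universal completeness of `R(T)`
and, through the formula for squares, closure of `R(T)` under products.

For positive `g` in `R(T)` and `f` in `E`, the truncated products `(g ∧ ne)f` lie in `E`, which is
an ideal of `U`, and they increase to `gf`. The inequality `T(hf) ≤ h T(f)` of `map_mul_le` bounds
their images under `T` by `g T(f)`, so `gf` lies in the natural domain. That inequality holds
because `T` respects inequalities local to an element of `R(T)` (`leOn_map`), and locally `h` is
nearly a scalar multiple of `e`. -/

namespace RieszCE

/-! ### Inequalities localized to the carrier of a positive element. -/

section LocalOrder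

variable {U : Type*} [AddCommGroup U] [Lattice U] [IsOrderedAddMonoid U]

theorem add_inf_eq_zero {a b d : U} (ha : 0 ≤ a) (hb : 0 ≤ b) (hd : 0 ≤ d)
    (had : a ⊓ d = 0) (hbd : b ⊓ d = 0) : (a + b) ⊓ d = 0 := by
  refine le_antisymm ?_ (le_inf (add_nonneg ha hb) hd)
  have h1 : (a + b) ⊓ d - b ≤ a ⊓ d :=
    le_inf (sub_le_iff_le_add.2 inf_le_left) ((sub_le_self _ hb).trans inf_le_right)
  rw [had, sub_nonpos] at h1
  exact (le_inf h1 inf_le_right).trans hbd.le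

omit [IsOrderedAddMonoid U] in
theorem inf_eq_zero_of_le {a b c d : U} (h : a ⊓ b = 0) (hc : 0 ≤ c) (hd : 0 ≤ d)
    (hca : c ≤ a) (hdb : d ≤ b) : c ⊓ d = 0 :=
  le_antisymm ((inf_le_inf hca hdb).trans h.le) (le_inf hc hd)

theorem nsmul_inf_eq_zero {a d : U} (ha : 0 ≤ a) (hd : 0 ≤ d) (h : a ⊓ d = 0) (n : ℕ) :
    (n • a) ⊓ d = 0 := by
  induction n with
  | zero => simpa using hd
  | succ k ih => rw [succ_nsmul]; exact add_inf_eq_zero (nsmul_nonneg ha _) ha hd ih h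

theorem posPart_le_of_le_add {x y z : U} (hz : 0 ≤ z) (h : x ≤ y + z) : (x - y)⁺ ≤ z :=
  sup_le (sub_le_iff_le_add'.2 h) hz

theorem le_add_posPart_sub (x y : U) : x ≤ y + (x - y)⁺ :=
  sub_le_iff_le_add'.1 (le_posPart _)

/-- The inequality `x ≤ y` holds on the carrier of `d`. -/
def LeOn (d x y : U) : Prop := ∃ z, 0 ≤ z ∧ z ⊓ d = 0 ∧ x ≤ y + z

/-- The element `(x - y)⁺` is the least admissible error, so it can be taken as the witness. -/
theorem leOn_iff {d x y : U} (hd : 0 ≤ d) : LeOn d x y ↔ (x - y)⁺ ⊓ d = 0 :=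
  ⟨fun ⟨_, hz, hzd, h⟩ =>
    inf_eq_zero_of_le hzd (posPart_nonneg _) hd (posPart_le_of_le_add hz h) le_rfl,
    fun h => ⟨(x - y)⁺, posPart_nonneg _, h, le_add_posPart_sub x y⟩⟩

namespace LeOn

variable {d x y z x' y' : U}

omit [IsOrderedAddMonoid U] in
theorem of_le (hd : 0 ≤ d) (h : x ≤ y) : LeOn d x y :=
  ⟨0, le_rfl, inf_eq_left.2 hd, by simpa using h⟩

theorem trans (hd : 0 ≤ d) (h : LeOn d x y) (h' : LeOn d y z) : LeOn d x z := by
  obtain ⟨a, ha, had, hxa⟩ := h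
  obtain ⟨b, hb, hbd, hyb⟩ := h'
  refine ⟨b + a, add_nonneg hb ha, add_inf_eq_zero hb ha hd hbd had, ?_⟩
  rw [← add_assoc]
  exact hxa.trans (add_le_add_left hyb a)

omit [IsOrderedAddMonoid U] in
theorem mono {d' : U} (hd' : 0 ≤ d') (hd : d' ≤ d) (h : LeOn d x y) : LeOn d' x y := by
  obtain ⟨a, ha, had, hxa⟩ := h
  exact ⟨a, ha, inf_eq_zero_of_le had ha hd' le_rfl hd, hxa⟩

theorem add (hd : 0 ≤ d) (h : LeOn d x y) (h' : LeOn d x' y') : LeOn d (x + x') (y + y') := by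
  obtain ⟨a, ha, had, hxa⟩ := h
  obtain ⟨b, hb, hbd, hyb⟩ := h'
  refine ⟨a + b, add_nonneg ha hb, add_inf_eq_zero ha hb hd had hbd, ?_⟩
  rw [add_add_add_comm]
  exact add_le_add hxa hyb

theorem sup (hd : 0 ≤ d) (h : LeOn d x y) (h' : LeOn d x' y') : LeOn d (x ⊔ x') (y ⊔ y') := by
  obtain ⟨a, ha, had, hxa⟩ := h
  obtain ⟨b, hb, hbd, hyb⟩ := h'
  refine ⟨a + b, add_nonneg ha hb, add_inf_eq_zero ha hb hd had hbd, sup_le ?_ ?_⟩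
  · exact hxa.trans (add_le_add le_sup_left (le_add_of_nonneg_right hb))
  · exact hyb.trans (add_le_add le_sup_right (le_add_of_nonneg_left ha))

theorem neg (h : LeOn d x y) : LeOn d (-y) (-x) := by
  obtain ⟨a, ha, had, hxa⟩ := h
  refine ⟨a, ha, had, ?_⟩
  rw [neg_add_eq_sub, neg_le_sub_iff_le_add, add_comm]
  exact hxa

theorem sub_nonneg_iff : LeOn d 0 (y - x) ↔ LeOn d x y := by
  refine exists_congr fun a => and_congr_right fun _ => and_congr_right fun _ => ?_
  rw [← sub_nonneg, sub_zero, ← sub_nonneg (b := x), add_sub_right_comm]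

/-- A local inequality passes to the least upper bound. -/
theorem of_isLUB {S : Set U} {u v : U} (hd : 0 ≤ d) (hu : IsLUB S u)
    (h : ∀ s ∈ S, LeOn d s v) : LeOn d u v := by
  rw [leOn_iff hd]
  have hz : 0 ≤ (u - v)⁺ ⊓ d := le_inf (posPart_nonneg _) hd
  refine le_antisymm ?_ hz
  -- The overlap `z` of `(u - v)⁺` with `d` is disjoint from each `(s - v)⁺`. Since `z - (u - s)`
  -- lies below both `z` and `(s - v)⁺`, it is at most `0`. So `u - z` is still an upper bound.
  have key : u ≤ u - (u - v)⁺ ⊓ d := by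
    refine hu.2 fun s hs => ?_
    have hsu : s ≤ u := hu.1 hs
    have h1 := (leOn_iff hd).1 (h s hs)
    set z := (u - v)⁺ ⊓ d
    have h2 : (s - v)⁺ ⊓ z = 0 :=
      inf_eq_zero_of_le h1 (posPart_nonneg _) hz le_rfl inf_le_right
    have h3 : z - (u - s) ≤ (s - v)⁺ := by
      have : z ≤ (u - v)⁺ := inf_le_left
      refine sub_le_iff_le_add.2 (this.trans (posPart_le_of_le_add
        (add_nonneg (posPart_nonneg _) (sub_nonneg.2 hsu)) ?_))
      have h4 : s ≤ v + (s - v)⁺ := le_add_posPart_sub s v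
      calc u = s + (u - s) := by abel
        _ ≤ v + (s - v)⁺ + (u - s) := add_le_add_left h4 _
        _ = _ := by abel
    have h5 : z - (u - s) ≤ 0 :=
      (le_inf h3 (sub_le_self z (sub_nonneg.2 hsu))).trans h2.le
    rw [sub_nonpos] at h5
    exact le_sub_comm.1 h5
  simpa using key

variable [Module ℝ U] [IsOrderedModule ℝ U]

theorem smul (hd : 0 ≤ d) (h : LeOn d x y) {c : ℝ} (hc : 0 ≤ c) : LeOn d (c • x) (c • y) := by
  obtain ⟨n, hn⟩ := exists_nat_ge c
  obtain ⟨a, ha, had, hxa⟩ := h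
  refine ⟨c • a, smul_nonneg hc ha, inf_eq_zero_of_le (nsmul_inf_eq_zero ha hd had n) (smul_nonneg hc ha) hd ?_ le_rfl, ?_⟩
  · rw [← Nat.cast_smul_eq_nsmul ℝ]
    exact smul_le_smul_of_nonneg_right hn ha
  · rw [← smul_add]
    exact smul_le_smul_of_nonneg_left hxa hc

end LeOn

end LocalOrder

/-! ### Comparison with multiples of a weak order unit. -/

section Units

variable {U : Type*} [AddCommGroup U] [Lattice U] [IsOrderedAddMonoid U] [Module ℝ U]
  [IsOrderedModule ℝ U]

/-- The Archimedean property of a Riesz space. -/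
def IsArchimedean (U : Type*) [AddCommGroup U] [Lattice U] : Prop :=
  ∀ x y : U, (∀ n : ℕ, n • x ≤ y) → x ≤ 0

omit [Module ℝ U] [IsOrderedModule ℝ U] in
theorem IsDedekindComplete.isArchimedean (hU : IsDedekindComplete U) : IsArchimedean U := by
  intro x y h
  obtain ⟨s, hs⟩ := hU (Set.range fun n : ℕ => n • x) (Set.range_nonempty _)
    ⟨y, by rintro _ ⟨n, rfl⟩; exact h n⟩
  have : s ≤ s - x := by
    refine hs.2 ?_
    rintro _ ⟨n, rfl⟩
    have := hs.1 ⟨n + 1, rfl⟩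
    simp only [succ_nsmul] at this
    exact le_sub_iff_add_le.2 this
  simpa using this

theorem IsArchimedean.le_of_forall_le_add_smul (hU : IsArchimedean U) {x y w : U} (hw : 0 ≤ w)
    (h : ∀ ε : ℝ, 0 < ε → x ≤ y + ε • w) : x ≤ y := by
  rw [← sub_nonpos]
  refine hU _ w fun n => ?_
  rcases n.eq_zero_or_pos with rfl | hn
  · simpa using hw
  · have hn' : (0 : ℝ) < n := Nat.cast_pos.2 hn
    have := smul_le_smul_of_nonneg_left (sub_le_iff_le_add'.2 (h (n : ℝ)⁻¹ (inv_pos.2 hn'))) hn'.le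
    rwa [smul_inv_smul₀ hn'.ne', Nat.cast_smul_eq_nsmul] at this

variable {e : U}

/-- If `x ≤ y` fails then `x` exceeds `y` by a fixed multiple of the unit locally. -/
theorem exists_leOn_of_not_le (hU : IsArchimedean U) (he : 0 ≤ e) {x y : U} (h : ¬ x ≤ y) :
    ∃ d, 0 < d ∧ ∃ ε : ℝ, 0 < ε ∧ LeOn d (y + ε • e) x := by
  by_contra! H
  refine h (hU.le_of_forall_le_add_smul he fun ε hε => ?_)
  by_contra hx
  have hd : 0 < (x - (y + ε • e))⁺ := lt_of_le_of_ne (posPart_nonneg _) fun h0 =>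
    hx (sub_nonpos.1 (posPart_eq_zero.1 h0.symm))
  refine H _ hd ε hε ⟨_, negPart_nonneg (x - (y + ε • e)), ?_, ?_⟩
  · rw [inf_comm]; exact posPart_inf_negPart_eq_zero _
  · have := neg_le_negPart (x - (y + ε • e))
    rw [neg_sub, sub_le_iff_le_add'] at this
    exact this

/-- After rescaling, the inequality would make `e` disjoint from `d`, which a weak unit forbids. -/
theorem LeOn.not_smul_lt {d : U} (he : IsWeakOrderUnit e) (hd : 0 < d) {r s : ℝ} (hrs : s < r) :
    ¬ LeOn d (r • e) (s • e) := by
  intro h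
  have h1 := h.smul hd.le (inv_nonneg.2 (sub_pos.2 hrs).le)
  rw [leOn_iff hd.le, ← smul_sub, ← sub_smul, smul_smul, inv_mul_cancel₀ (sub_pos.2 hrs).ne',
    one_smul, posPart_of_nonneg he.1] at h1
  exact hd.ne' (he.2 d (by rwa [abs_of_nonneg hd.le]))

omit [Module ℝ U] [IsOrderedModule ℝ U] in
/-- Every element is locally bounded by a multiple of the unit. -/
theorem exists_leOn_bound (hU : IsArchimedean U) (he : IsWeakOrderUnit e) (x : U) {d : U}
    (hd : 0 < d) : ∃ d', 0 < d' ∧ d' ≤ d ∧ ∃ N : ℕ, LeOn d' |x| (N • e) := by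
  by_contra! H
  -- A nonzero intersection would be a piece of `d` on which `|x| ≤ n • e`. So `n • e ≤ |x|` on `d`
  -- for every `n`.
  have h0 : ∀ n : ℕ, (n • e - |x|)⁺ ⊓ d = 0 := by
    intro n
    by_contra hn
    refine H ((n • e - |x|)⁺ ⊓ d)
      (lt_of_le_of_ne (le_inf (posPart_nonneg _) hd.le) (Ne.symm hn)) inf_le_right n
      (LeOn.mono (d := (n • e - |x|)⁺) (le_inf (posPart_nonneg _) hd.le) inf_le_left ?_)
    rw [leOn_iff (posPart_nonneg _), ← neg_sub (n • e), posPart_neg, inf_comm]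
    exact posPart_inf_negPart_eq_zero _
  have h1 : e ⊓ d ≤ 0 := by
    refine hU _ |x| fun n => ?_
    have hw : (n • (e ⊓ d) - |x|)⁺ ⊓ d = 0 := by
      refine inf_eq_zero_of_le (h0 n) (posPart_nonneg _) hd.le (posPart_mono ?_) le_rfl
      exact sub_le_sub_right (nsmul_le_nsmul_right inf_le_left n) _
    have hd0 : 0 ≤ e ⊓ d := le_inf he.1 hd.le
    have h2 : LeOn d (n • (e ⊓ d)) |x| := (leOn_iff hd.le).2 hw
    -- The excess is itself below `n • d`, so being disjoint from `n • d` makes it zero: the local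
    -- inequality is global.
    have h3 : (n • (e ⊓ d) - |x|)⁺ ⊓ (n • d) = 0 := by
      rw [leOn_iff hd.le] at h2
      rw [inf_comm] at h2 ⊢
      exact nsmul_inf_eq_zero hd.le (posPart_nonneg _) h2 n
    have h4 : (n • (e ⊓ d) - |x|)⁺ ≤ n • d :=
      sup_le ((sub_le_self _ (abs_nonneg x)).trans (nsmul_le_nsmul_right inf_le_right n))
        (nsmul_nonneg hd.le n)
    rw [inf_eq_left.2 h4, posPart_eq_zero, sub_nonpos] at h3
    exact h3
  refine hd.ne' (he.2 d ?_)
  rw [abs_of_nonneg hd.le]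
  exact le_antisymm h1 (le_inf he.1 hd.le)

/-- Locally, an element lies within `ε` of a scalar multiple of the unit. -/
theorem exists_leOn_approx (hU : IsArchimedean U) (he : IsWeakOrderUnit e) (x : U) {d : U}
    (hd : 0 < d) {ε : ℝ} (hε : 0 < ε) :
    ∃ d', 0 < d' ∧ d' ≤ d ∧ ∃ r : ℝ, LeOn d' (r • e) x ∧ LeOn d' x ((r + ε) • e) := by
  obtain ⟨d₁, hd₁, hdd, N, hN⟩ := exists_leOn_bound hU he x hd
  -- Bisection starting from `[-N, N]`. Either `x` lies below the midpoint on all of `d'`, or `d'`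
  -- shrinks to a piece on which `x` lies above it.
  have key : ∀ n : ℕ, ∃ d', 0 < d' ∧ d' ≤ d ∧ ∃ r : ℝ, LeOn d' (r • e) x ∧
      LeOn d' x ((r + 2 * N / 2 ^ n) • e) := by
    intro n
    induction n with
    | zero =>
      refine ⟨d₁, hd₁, hdd, -N, ?_, ?_⟩
      · have := (hN.trans hd₁.le (LeOn.of_le hd₁.le le_rfl)).neg
        rw [neg_smul, Nat.cast_smul_eq_nsmul]
        exact this.trans hd₁.le (LeOn.of_le hd₁.le (neg_le.1 (neg_le_abs x)))
      · have : (-(N : ℝ) + 2 * N / 2 ^ 0) = N := by ring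
        rw [this, Nat.cast_smul_eq_nsmul]
        exact (LeOn.of_le hd₁.le (le_abs_self x)).trans hd₁.le hN
    | succ n ih =>
      obtain ⟨d', hd', hdd', r, h1, h2⟩ := ih
      set m : ℝ := r + 2 * N / 2 ^ (n + 1) with hm
      by_cases h : (x - m • e)⁺ ⊓ d' = 0
      · exact ⟨d', hd', hdd', r, h1, (leOn_iff hd'.le).2 h⟩
      · have h0 : 0 < (x - m • e)⁺ ⊓ d' :=
          lt_of_le_of_ne (le_inf (posPart_nonneg _) hd'.le) (Ne.symm h)
        refine ⟨_, h0, inf_le_right.trans hdd', m, ?_, ?_⟩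
        · refine LeOn.mono (d := (x - m • e)⁺) h0.le inf_le_left ?_
          rw [leOn_iff (posPart_nonneg _), ← neg_sub x, posPart_neg, inf_comm]
          exact posPart_inf_negPart_eq_zero _
        · have : m + 2 * N / 2 ^ (n + 1) = r + 2 * N / 2 ^ n := by
            rw [hm, pow_succ]; field_simp; ring
          rw [this]
          exact h2.mono h0.le inf_le_right
  obtain ⟨n, hn⟩ := exists_nat_gt (2 * N / ε)
  obtain ⟨d', hd', hdd', r, h1, h2⟩ := key n
  refine ⟨d', hd', hdd', r, h1, h2.trans hd'.le (LeOn.of_le hd'.le ?_)⟩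
  refine smul_le_smul_of_nonneg_right ?_ he.1
  have h2n : (n : ℝ) < 2 ^ n := by exact_mod_cast Nat.lt_two_pow_self
  have : 2 * (N : ℝ) / 2 ^ n ≤ ε := by
    rw [div_le_iff₀ (by positivity)]
    have := (div_lt_iff₀ hε).1 hn
    nlinarith
  linarith

end Units

/-! ### Points as maximal filters, and real values of elements at points. -/

section Points

variable {U : Type*} [AddCommGroup U] [Lattice U]

/-- A maximal filter of strictly positive elements. -/
structure IsPoint (p : Set U) : Prop where
  nonempty : p.Nonempty
  pos : ∀ d ∈ p, 0 < d
  inf_mem : ∀ d ∈ p, ∀ d' ∈ p, d ⊓ d' ∈ p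
  ultra : ∀ y, 0 ≤ y → (∃ d ∈ p, d ≤ y) ∨ ∃ d ∈ p, y ⊓ d = 0

theorem exists_isPoint {d : U} (hd : 0 < d) : ∃ p : Set U, IsPoint p ∧ d ∈ p := by
  obtain ⟨p, hdp, hmax⟩ := zorn_subset_nonempty
    {p : Set U | (∀ x ∈ p, 0 < x) ∧ ∀ x ∈ p, ∀ y ∈ p, x ⊓ y ∈ p} (by
      intro c hc hchain hne
      refine ⟨⋃₀ c, ⟨?_, ?_⟩, fun s hs => Set.subset_sUnion_of_mem hs⟩
      · rintro x ⟨s, hs, hx⟩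
        exact (hc hs).1 x hx
      · rintro x ⟨s, hs, hx⟩ y ⟨t, ht, hy⟩
        rcases hchain.total hs ht with h | h
        · exact ⟨t, ht, (hc ht).2 x (h hx) y hy⟩
        · exact ⟨s, hs, (hc hs).2 x hx y (h hy)⟩) {d}
    ⟨by rintro _ rfl; exact hd, by rintro _ rfl _ rfl; simp⟩
  have hdp' : d ∈ p := hdp rfl
  refine ⟨p, ⟨⟨d, hdp'⟩, hmax.prop.1, hmax.prop.2, fun y hy => ?_⟩, hdp'⟩
  by_contra! H
  obtain ⟨H1, H2⟩ := H
  -- If `y` meets every member of `p`, all elements `y ⊓ x` can be adjoined; by maximality they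
  -- already belong to `p`, and they lie below `y`.
  have hle := hmax.le_of_ge (y := p ∪ {z | ∃ x ∈ p, z = y ⊓ x}) ⟨?_, ?_⟩ Set.subset_union_left
  · exact H1 _ (hle (Or.inr ⟨d, hdp', rfl⟩)) inf_le_left
  · rintro x (hx | ⟨x, hx, rfl⟩)
    · exact hmax.prop.1 x hx
    · exact lt_of_le_of_ne (le_inf hy (hmax.prop.1 x hx).le) (Ne.symm (H2 x hx))
  · rintro x (hx | ⟨x, hx, rfl⟩) z (hz | ⟨z, hz, rfl⟩)
    · exact Or.inl (hmax.prop.2 x hx z hz)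
    · exact Or.inr ⟨_, hmax.prop.2 x hx z hz, inf_left_comm _ _ _⟩
    · exact Or.inr ⟨_, hmax.prop.2 x hx z hz, inf_assoc _ _ _⟩
    · exact Or.inr ⟨_, hmax.prop.2 x hx z hz, by rw [inf_inf_inf_comm, inf_idem]⟩

/-- The inequality `x ≤ y` holds near the point `p`. -/
def LeAt (p : Set U) (x y : U) : Prop := ∃ d ∈ p, LeOn d x y

variable {p : Set U} {x y z x' y' : U}

theorem LeAt.of_le (hp : IsPoint p) (h : x ≤ y) : LeAt p x y :=
  hp.nonempty.imp fun _ hd => ⟨hd, LeOn.of_le (hp.pos _ hd).le h⟩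

theorem LeAt.exists_common (hp : IsPoint p) (h : LeAt p x y) (h' : LeAt p x' y') :
    ∃ d ∈ p, LeOn d x y ∧ LeOn d x' y' := by
  obtain ⟨d, hd, hxy⟩ := h
  obtain ⟨d', hd', hxy'⟩ := h'
  have hi := hp.inf_mem d hd d' hd'
  exact ⟨_, hi, hxy.mono (hp.pos _ hi).le inf_le_left, hxy'.mono (hp.pos _ hi).le inf_le_right⟩

variable [IsOrderedAddMonoid U]

theorem LeAt.trans (hp : IsPoint p) (h : LeAt p x y) (h' : LeAt p y z) : LeAt p x z := by
  obtain ⟨d, hd, h1, h2⟩ := h.exists_common hp h'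
  exact ⟨d, hd, h1.trans (hp.pos d hd).le h2⟩

theorem LeAt.add (hp : IsPoint p) (h : LeAt p x y) (h' : LeAt p x' y') :
    LeAt p (x + x') (y + y') := by
  obtain ⟨d, hd, h1, h2⟩ := h.exists_common hp h'
  exact ⟨d, hd, h1.add (hp.pos d hd).le h2⟩

theorem LeAt.sup (hp : IsPoint p) (h : LeAt p x y) (h' : LeAt p x' y') :
    LeAt p (x ⊔ x') (y ⊔ y') := by
  obtain ⟨d, hd, h1, h2⟩ := h.exists_common hp h'
  exact ⟨d, hd, h1.sup (hp.pos d hd).le h2⟩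

theorem LeAt.neg (h : LeAt p x y) : LeAt p (-y) (-x) :=
  h.imp fun _ hd => ⟨hd.1, hd.2.neg⟩

/-- Apply the dichotomy of a point to `(x - y)⁺`: if it dominates a member of `p`, the negative part
is disjoint from that member. -/
theorem LeAt.total (hp : IsPoint p) (x y : U) : LeAt p x y ∨ LeAt p y x := by
  rcases hp.ultra (x - y)⁺ (posPart_nonneg _) with ⟨d, hd, h⟩ | ⟨d, hd, h⟩
  · refine Or.inr ⟨d, hd, (leOn_iff (hp.pos d hd).le).2 ?_⟩
    rw [← neg_sub x, posPart_neg, inf_comm]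
    exact inf_eq_zero_of_le (posPart_inf_negPart_eq_zero (x - y)) (hp.pos d hd).le
      (negPart_nonneg _) h le_rfl
  · exact Or.inl ⟨d, hd, (leOn_iff (hp.pos d hd).le).2 h⟩

variable [Module ℝ U] [IsOrderedModule ℝ U]

theorem LeAt.smul (hp : IsPoint p) (h : LeAt p x y) {c : ℝ} (hc : 0 ≤ c) :
    LeAt p (c • x) (c • y) :=
  h.imp fun d hd => ⟨hd.1, hd.2.smul (hp.pos d hd.1).le hc⟩

theorem LeAt.le_of_smul {e : U} (hp : IsPoint p) (he : IsWeakOrderUnit e) {r s : ℝ}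
    (h : LeAt p (r • e) (s • e)) : r ≤ s := by
  obtain ⟨d, hd, h⟩ := h
  exact not_lt.1 fun hrs => LeOn.not_smul_lt he (hp.pos d hd) hrs h

/-- The element `x` takes the real value `r` at the point `p`, relative to the unit `e`. -/
def HasVal (e : U) (p : Set U) (x : U) (r : ℝ) : Prop :=
  ∀ ε : ℝ, 0 < ε → LeAt p x ((r + ε) • e) ∧ LeAt p ((r - ε) • e) x

namespace HasVal

variable {e : U} {r s : ℝ}

theorem unit (hp : IsPoint p) (he : 0 ≤ e) : HasVal e p e 1 := fun ε hε => by
  constructor <;> refine LeAt.of_le hp ?_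
  · calc e = (1 : ℝ) • e := (one_smul _ _).symm
      _ ≤ _ := smul_le_smul_of_nonneg_right (by linarith) he
  · calc _ ≤ (1 : ℝ) • e := smul_le_smul_of_nonneg_right (by linarith) he
      _ = e := one_smul _ _

omit [IsOrderedModule ℝ U] in
theorem add (hp : IsPoint p) (hx : HasVal e p x r) (hy : HasVal e p y s) :
    HasVal e p (x + y) (r + s) := fun ε hε => by
  have h1 := hx (ε / 2) (half_pos hε)
  have h2 := hy (ε / 2) (half_pos hε)
  have e1 : (r + s + ε) • e = (r + ε / 2) • e + (s + ε / 2) • e := by module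
  have e2 : (r + s - ε) • e = (r - ε / 2) • e + (s - ε / 2) • e := by module
  rw [e1, e2]
  exact ⟨h1.1.add hp h2.1, h1.2.add hp h2.2⟩

omit [IsOrderedModule ℝ U] in
theorem neg (hx : HasVal e p x r) : HasVal e p (-x) (-r) := fun ε hε => by
  have h1 := hx ε hε
  have e1 : (-r + ε) • e = -((r - ε) • e) := by module
  have e2 : (-r - ε) • e = -((r + ε) • e) := by module
  rw [e1, e2]
  exact ⟨h1.2.neg, h1.1.neg⟩

omit [IsOrderedModule ℝ U] in
theorem sub (hp : IsPoint p) (hx : HasVal e p x r) (hy : HasVal e p y s) :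
    HasVal e p (x - y) (r - s) := by
  rw [sub_eq_add_neg, sub_eq_add_neg]
  exact hx.add hp hy.neg

theorem zero (hp : IsPoint p) (he : 0 ≤ e) : HasVal e p (0 : U) 0 := by
  simpa using (unit hp he).sub hp (unit hp he)

theorem smul (hp : IsPoint p) (he : 0 ≤ e) (hx : HasVal e p x r) (c : ℝ) :
    HasVal e p (c • x) (c * r) := by
  have key : ∀ c : ℝ, 0 < c → HasVal e p (c • x) (c * r) := fun c hc ε hε => by
    have h1 := hx (ε / c) (div_pos hε hc)
    have e1 : (c * r + ε) • e = c • (r + ε / c) • e := by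
      rw [smul_smul, mul_add, mul_div_cancel₀ _ hc.ne']
    have e2 : (c * r - ε) • e = c • (r - ε / c) • e := by
      rw [smul_smul, mul_sub, mul_div_cancel₀ _ hc.ne']
    rw [e1, e2]
    exact ⟨h1.1.smul hp hc.le, h1.2.smul hp hc.le⟩
  rcases lt_trichotomy c 0 with hc | rfl | hc
  · simpa using (key (-c) (neg_pos.2 hc)).neg
  · simpa using zero hp he
  · exact key c hc

theorem sup (hp : IsPoint p) (he : 0 ≤ e) (hx : HasVal e p x r) (hy : HasVal e p y s) :
    HasVal e p (x ⊔ y) (max r s) := fun ε hε => by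
  have h1 := hx ε hε
  have h2 := hy ε hε
  constructor
  · refine (h1.1.sup hp h2.1).trans hp (LeAt.of_le hp (sup_le ?_ ?_)) <;>
      refine smul_le_smul_of_nonneg_right ?_ he <;> gcongr
    exacts [le_max_left _ _, le_max_right _ _]
  · rcases max_choice r s with h | h <;> rw [h]
    · exact h1.2.trans hp (LeAt.of_le hp le_sup_left)
    · exact h2.2.trans hp (LeAt.of_le hp le_sup_right)

theorem inf (hp : IsPoint p) (he : 0 ≤ e) (hx : HasVal e p x r) (hy : HasVal e p y s) :
    HasVal e p (x ⊓ y) (min r s) := by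
  have h := (hx.neg.sup hp he hy.neg).neg
  rwa [neg_sup, neg_neg, neg_neg, max_neg_neg, neg_neg] at h

theorem abs (hp : IsPoint p) (he : 0 ≤ e) (hx : HasVal e p x r) : HasVal e p |x| |r| :=
  hx.sup hp he hx.neg

theorem le_of_leAt (hp : IsPoint p) (he : IsWeakOrderUnit e) (hx : HasVal e p x r)
    (hy : HasVal e p y s) (h : LeAt p x y) : r ≤ s := by
  refine le_of_forall_pos_le_add fun ε hε => ?_
  have h1 := (hx (ε / 2) (half_pos hε)).2
  have h2 := (hy (ε / 2) (half_pos hε)).1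
  have := LeAt.le_of_smul hp he ((h1.trans hp h).trans hp h2)
  linarith

theorem mono (hp : IsPoint p) (he : IsWeakOrderUnit e) (hx : HasVal e p x r)
    (hy : HasVal e p y s) (h : x ≤ y) : r ≤ s :=
  hx.le_of_leAt hp he hy (LeAt.of_le hp h)

theorem nonneg (hp : IsPoint p) (he : IsWeakOrderUnit e) (hx : HasVal e p x r)
    (h : 0 ≤ x) : 0 ≤ r :=
  (zero hp he.1).mono hp he hx h

theorem unique (hp : IsPoint p) (he : IsWeakOrderUnit e) (hx : HasVal e p x r)
    (hy : HasVal e p x s) : r = s :=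
  (hx.mono hp he hy le_rfl).antisymm (hy.mono hp he hx le_rfl)

end HasVal

variable {e : U}

/-- The value is the Dedekind cut of those `t` with `t • e ≤ x` near `p`; totality of the order at
`p` supplies the upper estimate. -/
theorem exists_hasVal (hp : IsPoint p) (he : IsWeakOrderUnit e) {N : ℕ}
    (h : LeAt p |x| (N • e)) : ∃ r, HasVal e p x r := by
  have hN : LeAt p (-(N : ℝ) • e) x := by
    rw [neg_smul, Nat.cast_smul_eq_nsmul]
    exact h.neg.trans hp (LeAt.of_le hp (neg_le.1 (neg_le_abs x)))
  have hN' : LeAt p x ((N : ℝ) • e) := by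
    rw [Nat.cast_smul_eq_nsmul]
    exact (LeAt.of_le hp (le_abs_self x)).trans hp h
  set S : Set ℝ := {t | LeAt p (t • e) x}
  have hS : BddAbove S := ⟨N, fun t ht => LeAt.le_of_smul hp he (LeAt.trans hp ht hN')⟩
  refine ⟨sSup S, fun ε hε => ⟨?_, ?_⟩⟩
  · refine (LeAt.total hp _ _).resolve_right fun h' => ?_
    have := le_csSup hS (show sSup S + ε ∈ S from h')
    linarith
  · obtain ⟨t, ht, hlt⟩ := exists_lt_of_lt_csSup (s := S) ⟨_, hN⟩ (sub_lt_self (sSup S) hε)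
    exact LeAt.trans hp (LeAt.of_le hp (smul_le_smul_of_nonneg_right hlt.le he.1)) ht

/-- Below any positive element lies a point at which finitely many given elements have values. -/
theorem exists_point_hasVal (hU : IsArchimedean U) (he : IsWeakOrderUnit e) (L : List U)
    {d : U} (hd : 0 < d) :
    ∃ p, IsPoint p ∧ (∃ d' ∈ p, d' ≤ d) ∧ ∀ z ∈ L, ∃ r, HasVal e p z r := by
  have key : ∃ d', 0 < d' ∧ d' ≤ d ∧ ∀ z ∈ L, ∃ N : ℕ, LeOn d' |z| (N • e) := by
    induction L with
    | nil => exact ⟨d, hd, le_rfl, by simp⟩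
    | cons a L ih =>
      obtain ⟨d₁, hd₁, hdd₁, h₁⟩ := ih
      obtain ⟨d₂, hd₂, hdd₂, h₂⟩ := exists_leOn_bound hU he a hd₁
      refine ⟨d₂, hd₂, hdd₂.trans hdd₁, fun z hz => ?_⟩
      rcases List.mem_cons.1 hz with rfl | hz
      · exact h₂
      · exact (h₁ z hz).imp fun N hN => hN.mono hd₂.le hdd₂
  obtain ⟨d', hd', hdd', h⟩ := key
  obtain ⟨p, hp, hdp⟩ := exists_isPoint hd'
  refine ⟨p, hp, ⟨d', hdp, hdd'⟩, fun z hz => ?_⟩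
  obtain ⟨N, hN⟩ := h z hz
  exact exists_hasVal hp he ⟨d', hdp, hN⟩

/-- An inequality holds as soon as it holds at the points where finitely many given elements
have values. -/
theorem le_of_hasVal (hU : IsArchimedean U) (he : IsWeakOrderUnit e) (L : List U) {x y : U}
    (h : ∀ p, IsPoint p → (∀ z ∈ L, ∃ r, HasVal e p z r) →
      ∃ r s, HasVal e p x r ∧ HasVal e p y s ∧ r ≤ s) : x ≤ y := by
  by_contra hxy
  obtain ⟨d, hd, ε, hε, hd'⟩ := exists_leOn_of_not_le hU he.1 hxy
  obtain ⟨p, hp, ⟨c, hcp, hcd⟩, hL⟩ := exists_point_hasVal hU he L hd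
  obtain ⟨r, s, hr, hs, hrs⟩ := h p hp hL
  have hle : LeAt p (y + ε • e) x := ⟨c, hcp, hd'.mono (hp.pos c hcp).le hcd⟩
  have := (hs.add hp ((HasVal.unit hp he.1).smul hp he.1 ε)).le_of_leAt hp he hr hle
  linarith

theorem eq_of_hasVal (hU : IsArchimedean U) (he : IsWeakOrderUnit e) (L : List U) {x y : U}
    (h : ∀ p, IsPoint p → (∀ z ∈ L, ∃ r, HasVal e p z r) →
      ∃ r, HasVal e p x r ∧ HasVal e p y r) : x = y :=
  le_antisymm
    (le_of_hasVal hU he L fun p hp hL =>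
      let ⟨r, h1, h2⟩ := h p hp hL; ⟨r, r, h1, h2, le_rfl⟩)
    (le_of_hasVal hU he L fun p hp hL =>
      let ⟨r, h1, h2⟩ := h p hp hL; ⟨r, r, h2, h1, le_rfl⟩)

end Points

/-! ### Existence of a product computed pointwise. -/

section Product

variable {U : Type*} [AddCommGroup U] [Lattice U] [IsOrderedAddMonoid U]

/-- An element agreeing with `w` on the carrier of `d` and vanishing on its disjoint complement. -/
theorem exists_localization (hU : IsDedekindComplete U) {d w : U} (hd : 0 ≤ d) (hw : 0 ≤ w) :
    ∃ v, 0 ≤ v ∧ LeOn d w v ∧ ∀ c, 0 ≤ c → d ⊓ c = 0 → v ⊓ c = 0 := by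
  obtain ⟨v, hv⟩ := hU (Set.range fun k : ℕ => (k • d) ⊓ w) (Set.range_nonempty _)
    ⟨w, by rintro _ ⟨k, rfl⟩; exact inf_le_right⟩
  have hvw : v ≤ w := hv.2 (by rintro _ ⟨k, rfl⟩; exact inf_le_right)
  have hv0 : 0 ≤ v := (le_inf (nsmul_nonneg hd 0) hw).trans (hv.1 ⟨0, rfl⟩)
  refine ⟨v, hv0, ?_, fun c hc hdc => ?_⟩
  · rw [leOn_iff hd, posPart_of_nonneg (sub_nonneg.2 hvw)]
    refine le_antisymm ?_ (le_inf (sub_nonneg.2 hvw) hd)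
    -- Adding `(w - v) ⊓ d` to the `k`-th term stays below the next term, so subtracting it from `v`
    -- still leaves an upper bound.
    have : v ≤ v - (w - v) ⊓ d := by
      refine hv.2 ?_
      rintro _ ⟨k, rfl⟩
      refine le_sub_iff_add_le.2 ((le_inf ?_ ?_).trans (hv.1 ⟨k + 1, rfl⟩))
      · simp only [succ_nsmul]
        exact add_le_add inf_le_left inf_le_right
      · calc _ ≤ v + (w - v) := add_le_add (hv.1 ⟨k, rfl⟩) inf_le_left
          _ = w := by abel
    simpa using this
  · have := LeOn.of_isLUB (v := 0) hc hv (by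
      rintro _ ⟨k, rfl⟩
      exact ⟨k • d, nsmul_nonneg hd k, nsmul_inf_eq_zero hd hc hdc k, by rw [zero_add]; exact inf_le_left⟩)
    rwa [leOn_iff hc, sub_zero, posPart_of_nonneg hv0] at this

variable [Module ℝ U] [IsOrderedModule ℝ U] {e : U}

/-- In a universally complete Riesz space, a locally bounded set is bounded above. -/
theorem bddAbove_of_locally_bounded (hU : IsUniversallyComplete U) (he : IsWeakOrderUnit e)
    {S : Set U} (hS : ∀ d, 0 < d → ∃ d', 0 < d' ∧ d' ≤ d ∧ ∃ N : ℕ, ∀ s ∈ S, LeOn d' s (N • e)) :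
    BddAbove S := by
  -- A maximal disjoint family of elements on each of which `S` has a uniform bound. The bounds, cut
  -- down to these carriers, are disjoint and are glued by a supremum.
  obtain ⟨F, -, hF⟩ := zorn_subset_nonempty
    {F : Set U | (∀ d ∈ F, 0 < d ∧ ∃ N : ℕ, ∀ s ∈ S, LeOn d s (N • e)) ∧
      F.Pairwise fun x y => x ⊓ y = 0} (by
      intro c hc hchain hne
      refine ⟨⋃₀ c, ⟨?_, ?_⟩, fun s hs => Set.subset_sUnion_of_mem hs⟩
      · rintro x ⟨s, hs, hx⟩
        exact (hc hs).1 x hx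
      · rintro x ⟨s, hs, hx⟩ y ⟨t, ht, hy⟩ hxy
        rcases hchain.total hs ht with h | h
        · exact (hc ht).2 (h hx) hy hxy
        · exact (hc hs).2 hx (h hy) hxy) ∅ ⟨by simp, by simp⟩
  choose! N hN using fun d hd => (hF.prop.1 d hd).2
  have hpos : ∀ d ∈ F, 0 < d := fun d hd => (hF.prop.1 d hd).1
  choose! v hv0 hNv hv using fun d (hd : d ∈ F) =>
    exists_localization hU.1 (hpos d hd).le (nsmul_nonneg he.1 (N d))
  -- The added `0` keeps the set nonempty when `F` is empty.
  obtain ⟨u, hu⟩ := hU.2 (insert 0 (v '' F)) (Set.insert_nonempty _ _) (by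
    have key : ∀ d ∈ F, ∀ d' ∈ F, v d ≠ v d' → AreDisjoint (v d) (v d') := by
      intro d hd d' hd' hne
      have h1 : d ⊓ d' = 0 := hF.prop.2 hd hd' fun h => hne (h ▸ rfl)
      have h2 := hv d hd d' (hpos d' hd').le h1
      rw [AreDisjoint, abs_of_nonneg (hv0 d hd), abs_of_nonneg (hv0 d' hd'), inf_comm]
      exact hv d' hd' _ (hv0 d hd) (by rw [inf_comm]; exact h2)
    rintro _ (rfl | ⟨d, hd, rfl⟩) _ (rfl | ⟨d', hd', rfl⟩) hne
    · exact absurd rfl hne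
    · simp [AreDisjoint]
    · simp [AreDisjoint]
    · exact key d hd d' hd' hne)
  refine ⟨u, fun s hs => ?_⟩
  by_contra hsu
  obtain ⟨d, hd, ε, hε, hle⟩ := exists_leOn_of_not_le hU.1.isArchimedean he.1 hsu
  obtain ⟨d', hd', hdd', hb⟩ := hS d hd
  -- Otherwise `d'` could be added to `F`; by maximality it would be a member, hence disjoint from
  -- itself.
  have hex : ∃ f ∈ F, f ⊓ d' ≠ 0 := by
    by_contra! H
    have hmem : insert d' F ⊆ F := hF.le_of_ge ⟨?_, ?_⟩ (Set.subset_insert _ _)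
    · exact hd'.ne' (by simpa using H d' (hmem (Set.mem_insert _ _)))
    · rintro x (rfl | hx)
      exacts [⟨hd', hb⟩, hF.prop.1 x hx]
    · rintro x (rfl | hx) y (rfl | hy) hxy
      · exact absurd rfl hxy
      · rw [inf_comm]; exact H y hy
      · exact H x hx
      · exact hF.prop.2 hx hy hxy
  obtain ⟨f, hf, hfd⟩ := hex
  have h0 : 0 < f ⊓ d' := lt_of_le_of_ne (le_inf (hpos f hf).le hd'.le) (Ne.symm hfd)
  have h1 : LeOn (f ⊓ d') (u + ε • e) s := hle.mono h0.le (inf_le_right.trans hdd')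
  have h2 : LeOn (f ⊓ d') s (v f) :=
    ((hN f hf s hs).trans (hpos f hf).le (hNv f hf)).mono h0.le inf_le_left
  have h3 : LeOn (f ⊓ d') (v f) u := LeOn.of_le h0.le (hu.1 (Or.inr ⟨f, hf, rfl⟩))
  have h4 := (((h1.trans h0.le h2).trans h0.le h3).add h0.le (LeOn.of_le h0.le (le_refl (-u))))
  refine LeOn.not_smul_lt he h0 hε ?_
  simpa using h4

/-- The elements `2 t a - t² e`, whose supremum is the square of `a`. -/
def squareMinorants (e a : U) : Set U := Set.range fun t : ℝ => (2 * t) • a - t ^ 2 • e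

/-- From `(t - q)² ≥ 0` follows `2tq - t² ≤ q² ≤ c`, with `q` the upper bound `r` when `t ≥ 0` and
the lower bound `s` when `t ≤ 0`. -/
theorem squareMinorants_leOn {a d : U} (hd : 0 ≤ d) (he : 0 ≤ e) {r s c : ℝ}
    (h1 : LeOn d a (r • e)) (h2 : LeOn d (s • e) a) (hr : r ^ 2 ≤ c) (hs : s ^ 2 ≤ c) :
    ∀ x ∈ squareMinorants e a, LeOn d x (c • e) := by
  rintro _ ⟨t, rfl⟩
  have key : ∀ q : ℝ, q ^ 2 ≤ c → LeOn d ((2 * t) • a) ((2 * t) • q • e) →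
      LeOn d ((2 * t) • a - t ^ 2 • e) (c • e) := fun q hq h => by
    have h' := h.add hd (LeOn.of_le hd (le_refl (-(t ^ 2 • e))))
    rw [← sub_eq_add_neg] at h'
    refine h'.trans hd (LeOn.of_le hd ?_)
    have : (2 * t) • q • e + -(t ^ 2 • e) = (2 * t * q - t ^ 2) • e := by module
    rw [this]
    exact smul_le_smul_of_nonneg_right (by nlinarith [sq_nonneg (t - q)]) he
  rcases le_total 0 t with ht | ht
  · exact key r hr (h1.smul hd (by positivity))
  · refine key s hs ?_
    have := (h2.smul hd (c := -(2 * t)) (by linarith)).neg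
    simpa using this

theorem exists_isLUB_squareMinorants (hU : IsUniversallyComplete U) (he : IsWeakOrderUnit e)
    (a : U) : ∃ u, IsLUB (squareMinorants e a) u := by
  refine hU.1 _ (Set.range_nonempty _) (bddAbove_of_locally_bounded hU he fun d hd => ?_)
  obtain ⟨d', hd', hdd', N, hN⟩ := exists_leOn_bound hU.1.isArchimedean he a hd
  refine ⟨d', hd', hdd', N ^ 2, ?_⟩
  have h1 : LeOn d' a ((N : ℝ) • e) := by
    rw [Nat.cast_smul_eq_nsmul]
    exact (LeOn.of_le hd'.le (le_abs_self a)).trans hd'.le hN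
  have h2 : LeOn d' ((-(N : ℝ)) • e) a := by
    rw [neg_smul, Nat.cast_smul_eq_nsmul]
    exact hN.neg.trans hd'.le (LeOn.of_le hd'.le (neg_le.1 (neg_le_abs a)))
  have := squareMinorants_leOn (c := N ^ 2) hd'.le he.1 h1 h2 le_rfl (by simp)
  simpa [← Nat.cast_smul_eq_nsmul ℝ] using this

/-- The upper estimate squares local bounds of `a`; the lower one uses the single minorant with `t =
r`. -/
theorem HasVal.of_isLUB_squareMinorants (he : IsWeakOrderUnit e) {p : Set U} (hp : IsPoint p)
    {a u : U} {r : ℝ} (ha : HasVal e p a r) (hu : IsLUB (squareMinorants e a) u) :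
    HasVal e p u (r ^ 2) := by
  intro ε hε
  constructor
  -- With this choice `(r ± δ)² ≤ r² + δ(2|r| + 1) ≤ r² + ε`.
  · set δ : ℝ := min 1 (ε / (2 * |r| + 1)) with hδ
    have hr := abs_nonneg r
    have hδ0 : 0 < δ := lt_min one_pos (by positivity)
    have h1 : δ ≤ 1 := min_le_left _ _
    have h2 : δ * (2 * |r| + 1) ≤ ε := (le_div_iff₀ (by positivity)).1 (min_le_right _ _)
    have h3 : δ ^ 2 ≤ δ := by nlinarith
    obtain ⟨d, hd, hu1, hu2⟩ := (ha δ hδ0).1.exists_common hp (ha δ hδ0).2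
    have hd0 := (hp.pos d hd).le
    refine ⟨d, hd, LeOn.of_isLUB hd0 hu (squareMinorants_leOn hd0 he.1 hu1 hu2 ?_ ?_)⟩
    · nlinarith [le_abs_self r]
    · nlinarith [neg_abs_le r]
  · have hm := ((ha.smul hp he.1 (2 * r)).sub hp
      ((HasVal.unit hp he.1).smul hp he.1 (r ^ 2)) ε hε).2
    have e1 : 2 * r * r - r ^ 2 * 1 = r ^ 2 := by ring
    rw [e1] at hm
    exact hm.trans hp (LeAt.of_le hp (hu.1 ⟨r, rfl⟩))

/-- Polarization of the squares; bilinearity is checked at points. The formula through `q` is kept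
because it later shows that `R(T)` is closed under products. -/
theorem exists_product_hasVal (hU : IsUniversallyComplete U) (he : IsWeakOrderUnit e) :
    ∃ q : U → U, (∀ a, IsLUB (squareMinorants e a) (q a)) ∧ ∃ m : U →ₗ[ℝ] U →ₗ[ℝ] U,
      (∀ a b, m a b = (4⁻¹ : ℝ) • (q (a + b) - q (a - b))) ∧
      ∀ p, IsPoint p → ∀ a b r s, HasVal e p a r → HasVal e p b s →
        HasVal e p (m a b) (r * s) := by
  choose q hq using exists_isLUB_squareMinorants hU he
  have hval : ∀ p, IsPoint p → ∀ a b r s, HasVal e p a r → HasVal e p b s →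
      HasVal e p ((4⁻¹ : ℝ) • (q (a + b) - q (a - b))) (r * s) := by
    intro p hp a b r s ha hb
    have h1 := (ha.add hp hb).of_isLUB_squareMinorants he hp (hq _)
    have h2 := (ha.sub hp hb).of_isLUB_squareMinorants he hp (hq _)
    convert (h1.sub hp h2).smul hp he.1 4⁻¹ using 1
    ring
  have hA := hU.1.isArchimedean
  refine ⟨q, hq, LinearMap.mk₂ ℝ (fun a b => (4⁻¹ : ℝ) • (q (a + b) - q (a - b))) ?_ ?_ ?_ ?_,
    fun a b => rfl, hval⟩
  · intro a b c
    refine eq_of_hasVal hA he [a, b, c] fun p hp hL => ?_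
    simp only [List.mem_cons, List.not_mem_nil, or_false, forall_eq_or_imp, forall_eq] at hL
    obtain ⟨⟨r, hr⟩, ⟨s, hs⟩, ⟨t, ht⟩⟩ := hL
    refine ⟨_, hval p hp _ _ _ _ (hr.add hp hs) ht, ?_⟩
    rw [add_mul]
    exact (hval p hp _ _ _ _ hr ht).add hp (hval p hp _ _ _ _ hs ht)
  · intro c a b
    refine eq_of_hasVal hA he [a, b] fun p hp hL => ?_
    simp only [List.mem_cons, List.not_mem_nil, or_false, forall_eq_or_imp, forall_eq] at hL
    obtain ⟨⟨r, hr⟩, ⟨s, hs⟩⟩ := hL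
    refine ⟨_, hval p hp _ _ _ _ (hr.smul hp he.1 c) hs, ?_⟩
    rw [mul_assoc]
    exact (hval p hp _ _ _ _ hr hs).smul hp he.1 c
  · intro a b c
    refine eq_of_hasVal hA he [a, b, c] fun p hp hL => ?_
    simp only [List.mem_cons, List.not_mem_nil, or_false, forall_eq_or_imp, forall_eq] at hL
    obtain ⟨⟨r, hr⟩, ⟨s, hs⟩, ⟨t, ht⟩⟩ := hL
    refine ⟨_, hval p hp _ _ _ _ hr (hs.add hp ht), ?_⟩
    rw [mul_add]
    exact (hval p hp _ _ _ _ hr hs).add hp (hval p hp _ _ _ _ hr ht)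
  · intro c a b
    refine eq_of_hasVal hA he [a, b] fun p hp hL => ?_
    simp only [List.mem_cons, List.not_mem_nil, or_false, forall_eq_or_imp, forall_eq] at hL
    obtain ⟨⟨r, hr⟩, ⟨s, hs⟩⟩ := hL
    refine ⟨_, hval p hp _ _ _ _ hr (hs.smul hp he.1 c), ?_⟩
    rw [mul_left_comm]
    exact (hval p hp _ _ _ _ hr hs).smul hp he.1 c

/-- A bilinear product computed pointwise is an `f`-algebra product. -/
theorem isFAlgebraProduct_of_hasVal (hA : IsArchimedean U) (he : IsWeakOrderUnit e)
    {m : U →ₗ[ℝ] U →ₗ[ℝ] U} (hval : ∀ p, IsPoint p → ∀ a b r s, HasVal e p a r →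
      HasVal e p b s → HasVal e p (m a b) (r * s)) : IsFAlgebraProduct m e := by
  have hdisj : ∀ a b c, a ⊓ b = 0 → 0 ≤ c → ∀ p, IsPoint p → ∀ r s t, HasVal e p a r →
      HasVal e p b s → HasVal e p c t → min (t * r) s = 0 := by
    intro a b c hab hc p hp r s t hr hs ht
    have h1 : min r s = 0 :=
      (hr.inf hp he.1 hs).unique hp he (by rw [hab]; exact HasVal.zero hp he.1)
    have h2 : 0 ≤ t := ht.nonneg hp he hc
    have h3 : 0 ≤ r := by rw [← h1]; exact min_le_left _ _
    have h4 : 0 ≤ s := by rw [← h1]; exact min_le_right _ _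
    rcases min_choice r s with h | h <;> rw [h1] at h <;> subst h <;> simp [h4, mul_nonneg h2 h3]
  refine ⟨?_, ?_, ?_, ?_, ?_, ?_⟩
  · intro a b c
    refine eq_of_hasVal hA he [a, b, c] fun p hp hL => ?_
    simp only [List.mem_cons, List.not_mem_nil, or_false, forall_eq_or_imp, forall_eq] at hL
    obtain ⟨⟨r, hr⟩, ⟨s, hs⟩, ⟨t, ht⟩⟩ := hL
    refine ⟨_, hval p hp _ _ _ _ (hval p hp _ _ _ _ hr hs) ht, ?_⟩
    rw [mul_assoc]
    exact hval p hp _ _ _ _ hr (hval p hp _ _ _ _ hs ht)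
  · intro a
    refine eq_of_hasVal hA he [a] fun p hp hL => ?_
    obtain ⟨r, hr⟩ := hL a (by simp)
    exact ⟨r, by simpa using hval p hp _ _ _ _ (HasVal.unit hp he.1) hr, hr⟩
  · intro a
    refine eq_of_hasVal hA he [a] fun p hp hL => ?_
    obtain ⟨r, hr⟩ := hL a (by simp)
    exact ⟨r, by simpa using hval p hp _ _ _ _ hr (HasVal.unit hp he.1), hr⟩
  · intro a b ha hb
    refine le_of_hasVal hA he [a, b] fun p hp hL => ?_
    simp only [List.mem_cons, List.not_mem_nil, or_false, forall_eq_or_imp, forall_eq] at hL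
    obtain ⟨⟨r, hr⟩, ⟨s, hs⟩⟩ := hL
    exact ⟨_, _, HasVal.zero hp he.1, hval p hp _ _ _ _ hr hs,
      mul_nonneg (hr.nonneg hp he ha) (hs.nonneg hp he hb)⟩
  · intro a b c hab hc
    refine eq_of_hasVal hA he [a, b, c] fun p hp hL => ?_
    simp only [List.mem_cons, List.not_mem_nil, or_false, forall_eq_or_imp, forall_eq] at hL
    obtain ⟨⟨r, hr⟩, ⟨s, hs⟩, ⟨t, ht⟩⟩ := hL
    refine ⟨_, (hval p hp _ _ _ _ ht hr).inf hp he.1 hs, ?_⟩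
    rw [hdisj a b c hab hc p hp r s t hr hs ht]
    exact HasVal.zero hp he.1
  · intro a b c hab hc
    refine eq_of_hasVal hA he [a, b, c] fun p hp hL => ?_
    simp only [List.mem_cons, List.not_mem_nil, or_false, forall_eq_or_imp, forall_eq] at hL
    obtain ⟨⟨r, hr⟩, ⟨s, hs⟩, ⟨t, ht⟩⟩ := hL
    refine ⟨_, (hval p hp _ _ _ _ hr ht).inf hp he.1 hs, ?_⟩
    rw [mul_comm, hdisj a b c hab hc p hp r s t hr hs ht]
    exact HasVal.zero hp he.1

/-! ### Every `f`-algebra product with the given unit is computed pointwise. -/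

namespace IsFAlgebraProduct

variable {m : U →ₗ[ℝ] U →ₗ[ℝ] U}

-- Split both factors into positive and negative parts. The cross terms are the only negative
-- contributions, and the `f`-algebra axioms make them disjoint from `d`.
omit [IsOrderedModule ℝ U] in
theorem leOn_nonneg (hm : IsFAlgebraProduct m e) {d x y : U} (hd : 0 ≤ d)
    (hx : LeOn d 0 x) (hy : LeOn d 0 y) : LeOn d 0 (m x y) := by
  rw [leOn_iff hd, zero_sub, posPart_neg] at hx hy
  have hxp := posPart_nonneg x
  have hyp := posPart_nonneg y
  have hxn := negPart_nonneg x
  have hyn := negPart_nonneg y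
  refine ⟨m x⁺ y⁻ + m x⁻ y⁺, add_nonneg (hm.nonneg _ _ hxp hyn) (hm.nonneg _ _ hxn hyp),
    add_inf_eq_zero (hm.nonneg _ _ hxp hyn) (hm.nonneg _ _ hxn hyp) hd
      (hm.disjoint_left _ _ _ hy hxp) (hm.disjoint_right _ _ _ hx hyp), ?_⟩
  have h1 : m x y + (m x⁺ y⁻ + m x⁻ y⁺) = m x⁺ y⁺ + m x⁻ y⁻ := by
    have : m x y = m (x⁺ - x⁻) (y⁺ - y⁻) := by rw [posPart_sub_negPart, posPart_sub_negPart]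
    rw [this]
    simp only [map_sub, LinearMap.sub_apply]
    abel
  rw [h1]
  exact add_nonneg (hm.nonneg _ _ hxp hyp) (hm.nonneg _ _ hxn hyn)

omit [IsOrderedModule ℝ U] in
theorem leOn_mul_right (hm : IsFAlgebraProduct m e) {d x y z : U} (hd : 0 ≤ d)
    (h : LeOn d x y) (hz : 0 ≤ z) : LeOn d (m x z) (m y z) := by
  rw [← LeOn.sub_nonneg_iff] at h ⊢
  have := hm.leOn_nonneg hd h (LeOn.of_le hd hz)
  rwa [map_sub, LinearMap.sub_apply] at this

/-- Half of `(εe - x)(Ne + y) + (εe + x)(Ne - y)` equals `εNe - xy`, and all four factors are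
nonnegative on `d`. -/
theorem leOn_small (hm : IsFAlgebraProduct m e) {d x y : U} (hd : 0 ≤ d) {ε N : ℝ}
    (hx : LeOn d x (ε • e)) (hx' : LeOn d (-x) (ε • e)) (hy : LeOn d y (N • e))
    (hy' : LeOn d (-y) (N • e)) : LeOn d (m x y) ((ε * N) • e) := by
  have h1 := hm.leOn_nonneg hd (LeOn.sub_nonneg_iff.2 hx) (LeOn.sub_nonneg_iff.2 hy')
  have h2 := hm.leOn_nonneg hd (LeOn.sub_nonneg_iff.2 hx') (LeOn.sub_nonneg_iff.2 hy)
  have h3 := (h1.add hd h2).smul hd (c := 2⁻¹) (by norm_num)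
  rw [← LeOn.sub_nonneg_iff]
  convert h3 using 1
  · simp
  · simp only [map_sub, map_neg, map_smul, LinearMap.sub_apply, LinearMap.neg_apply,
      LinearMap.smul_apply, hm.one_mul, hm.mul_one]
    module

/-- An `f`-algebra product is computed pointwise. -/
theorem hasVal (hm : IsFAlgebraProduct m e) (he : IsWeakOrderUnit e) {p : Set U}
    (hp : IsPoint p) {a b : U} {r s : ℝ} (ha : HasVal e p a r) (hb : HasVal e p b s) :
    HasVal e p (m a b) (r * s) := by
  -- An infinitesimal factor times a finite one is infinitesimal. The general case follows from `ab
  -- = (a - re)b + rb`.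
  have hsmall : ∀ x y t, HasVal e p x 0 → HasVal e p y t → HasVal e p (m x y) 0 := by
    have key : ∀ x y t, HasVal e p x 0 → HasVal e p y t → ∀ ε : ℝ, 0 < ε →
        LeAt p (m x y) (ε • e) := by
      intro x y t hx hy ε hε
      have ht : 0 < |t| + 1 := by positivity
      have hδ : 0 < ε / (|t| + 1) := by positivity
      have hx1 := hx _ hδ
      have hx2 := hx.neg _ hδ
      have hy1 := hy 1 one_pos
      have hy2 := hy.neg 1 one_pos
      have hb : ∀ q : ℝ, q ≤ |t| → LeAt p ((q + 1) • e) ((|t| + 1) • e) := fun q hq =>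
        LeAt.of_le hp (smul_le_smul_of_nonneg_right (by linarith) he.1)
      rw [zero_add] at hx1
      rw [neg_zero, zero_add] at hx2
      obtain ⟨d₁, hd₁, h1, h2⟩ := hx1.1.exists_common hp hx2.1
      obtain ⟨d₂, hd₂, h3, h4⟩ := (hy1.1.trans hp (hb t (le_abs_self t))).exists_common hp
        (hy2.1.trans hp (hb (-t) (neg_le_abs t)))
      have hd := hp.inf_mem _ hd₁ _ hd₂
      have hd0 := (hp.pos _ hd).le
      have := hm.leOn_small hd0 (h1.mono hd0 inf_le_left) (h2.mono hd0 inf_le_left)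
        (h3.mono hd0 inf_le_right) (h4.mono hd0 inf_le_right)
      rw [div_mul_cancel₀ _ ht.ne'] at this
      exact ⟨_, hd, this⟩
    intro x y t hx hy ε hε
    rw [zero_add, zero_sub, neg_smul]
    refine ⟨key x y t hx hy ε hε, ?_⟩
    have := (key (-x) y t (by simpa using hx.neg) hy ε hε).neg
    simpa using this
  have hu := HasVal.unit hp he.1
  have h1 : HasVal e p (a - r • e) 0 := by simpa using ha.sub hp (hu.smul hp he.1 r)
  have h2 := (hsmall _ b s h1 hb).add hp (hb.smul hp he.1 r)
  have h3 : m (a - r • e) b + r • b = m a b := by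
    simp [hm.one_mul]
  rwa [h3, zero_add] at h2

/-- Uniqueness of the `f`-algebra product with a given unit. -/
theorem eq_of_hasVal (hA : IsArchimedean U) (he : IsWeakOrderUnit e)
    (hm : IsFAlgebraProduct m e) {m' : U →ₗ[ℝ] U →ₗ[ℝ] U} (hm' : IsFAlgebraProduct m' e) :
    m = m' := by
  ext a b
  refine RieszCE.eq_of_hasVal hA he [a, b] fun p hp hL => ?_
  simp only [List.mem_cons, List.not_mem_nil, or_false, forall_eq_or_imp, forall_eq] at hL
  obtain ⟨⟨r, hr⟩, ⟨s, hs⟩⟩ := hL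
  exact ⟨_, hm.hasVal he hp hr hs, hm'.hasVal he hp hr hs⟩

omit [IsOrderedModule ℝ U] in
theorem mono (hm : IsFAlgebraProduct m e) {a a' b b' : U} (ha : 0 ≤ a) (haa : a ≤ a')
    (hb : 0 ≤ b) (hbb : b ≤ b') : m a b ≤ m a' b' := by
  have h1 := hm.nonneg _ _ (sub_nonneg.2 haa) hb
  have h2 := hm.nonneg _ _ (ha.trans haa) (sub_nonneg.2 hbb)
  rw [map_sub, LinearMap.sub_apply, sub_nonneg] at h1
  rw [map_sub, sub_nonneg] at h2
  exact h1.trans h2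

theorem abs_le (hA : IsArchimedean U) (he : IsWeakOrderUnit e) (hm : IsFAlgebraProduct m e)
    (a b : U) : |m a b| ≤ m |a| |b| := by
  refine le_of_hasVal hA he [a, b] fun p hp hL => ?_
  simp only [List.mem_cons, List.not_mem_nil, or_false, forall_eq_or_imp, forall_eq] at hL
  obtain ⟨⟨r, hr⟩, ⟨s, hs⟩⟩ := hL
  exact ⟨_, _, (hm.hasVal he hp hr hs).abs hp he.1,
    hm.hasVal he hp (hr.abs hp he.1) (hs.abs hp he.1), (abs_mul r s).le⟩

/-- Truncations of the first factor approximate a product of positive elements. -/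
theorem isLUB_truncations (hA : IsArchimedean U) (he : IsWeakOrderUnit e)
    (hm : IsFAlgebraProduct m e) {a b : U} (ha : 0 ≤ a) (hb : 0 ≤ b) :
    IsLUB (Set.range fun n : ℕ => m (a ⊓ n • e) b) (m a b) := by
  constructor
  · rintro _ ⟨n, rfl⟩
    exact hm.mono (le_inf ha (nsmul_nonneg he.1 n)) inf_le_left hb le_rfl
  · intro v hv
    refine le_of_hasVal hA he [a, b, v] fun p hp hL => ?_
    simp only [List.mem_cons, List.not_mem_nil, or_false, forall_eq_or_imp, forall_eq] at hL
    obtain ⟨⟨r, hr⟩, ⟨s, hs⟩, ⟨t, ht⟩⟩ := hL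
    refine ⟨_, _, hm.hasVal he hp hr hs, ht, ?_⟩
    -- At a point where `a` has the finite value `r`, truncating at a level `n ≥ r` does not change
    -- that value.
    obtain ⟨n, hn⟩ := exists_nat_ge r
    have h1 : HasVal e p (n • e) n := by
      simpa [Nat.cast_smul_eq_nsmul] using (HasVal.unit hp he.1).smul hp he.1 (n : ℝ)
    have h2 := hm.hasVal he hp (hr.inf hp he.1 h1) hs
    rw [min_eq_left hn] at h2
    exact h2.mono hp he ht (hv ⟨n, rfl⟩)

end IsFAlgebraProduct

end Product

/-- A bilinear map corestricts along injective linear maps. -/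
theorem exists_bilinear_restrict {X Y Z U : Type*} [AddCommGroup X] [Module ℝ X] [AddCommGroup Y]
    [Module ℝ Y] [AddCommGroup Z] [Module ℝ Z] [AddCommGroup U] [Module ℝ U]
    (m : U →ₗ[ℝ] U →ₗ[ℝ] U) (i : X →ₗ[ℝ] U) (j : Y →ₗ[ℝ] U) (k : Z →ₗ[ℝ] U)
    (hk : Function.Injective k) (h : ∀ x y, ∃ z, k z = m (i x) (j y)) :
    ∃ B : X →ₗ[ℝ] Y →ₗ[ℝ] Z, ∀ x y, k (B x y) = m (i x) (j y) := by
  choose b hb using h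
  refine ⟨LinearMap.mk₂ ℝ b ?_ ?_ ?_ ?_, hb⟩ <;> intros <;> apply hk <;> simp [hb]

/-! ### Order density of `E` in its universal completion. -/

section Embedding

variable {E U : Type*} [AddCommGroup E] [Lattice E] [IsOrderedAddMonoid E] [Module ℝ E]
  [AddCommGroup U] [Lattice U] [IsOrderedAddMonoid U] [Module ℝ U] {ι : E →ₗ[ℝ] U}

namespace IsUniversalCompletion

omit [IsOrderedAddMonoid E] [IsOrderedAddMonoid U] in
theorem map_le_iff (hι : IsUniversalCompletion ι) {x y : E} : ι x ≤ ι y ↔ x ≤ y := by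
  rw [← sup_eq_right, ← hι.map_sup, hι.injective.eq_iff, sup_eq_right]

omit [IsOrderedAddMonoid E] [IsOrderedAddMonoid U] in
theorem map_nonneg_iff (hι : IsUniversalCompletion ι) {x : E} : 0 ≤ ι x ↔ 0 ≤ x := by
  rw [← map_zero ι, hι.map_le_iff]

theorem map_inf (hι : IsUniversalCompletion ι) (x y : E) : ι (x ⊓ y) = ι x ⊓ ι y := by
  rw [← neg_neg (x ⊓ y), neg_inf, map_neg, hι.map_sup, neg_sup, map_neg, map_neg, neg_neg, neg_neg]

omit [IsOrderedAddMonoid E] [IsOrderedAddMonoid U] in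
theorem map_abs (hι : IsUniversalCompletion ι) (x : E) : ι |x| = |ι x| := by
  rw [abs, abs, hι.map_sup, map_neg]

theorem map_leOn_iff (hι : IsUniversalCompletion ι) {d x y : E} (hd : 0 ≤ d) :
    LeOn (ι d) (ι x) (ι y) ↔ LeOn d x y := by
  have h : (ι x - ι y)⁺ = ι (x - y)⁺ := by
    rw [posPart_def, posPart_def, hι.map_sup, map_sub, map_zero]
  rw [leOn_iff hd, leOn_iff (hι.map_nonneg_iff.2 hd), h, ← hι.map_inf, map_eq_zero_iff ι hι.injective]

theorem map_isWeakOrderUnit (hι : IsUniversalCompletion ι) {e : E} (he : IsWeakOrderUnit e) :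
    IsWeakOrderUnit (ι e) := by
  refine ⟨hι.map_nonneg_iff.2 he.1, fun u hu => ?_⟩
  by_contra h0
  obtain ⟨x, hx0, hxu⟩ := hι.orderDense |u| (lt_of_le_of_ne (abs_nonneg u)
    fun h => h0 (le_antisymm ((le_abs_self u).trans h.symm.le)
      (neg_nonpos.1 ((neg_le_abs u).trans h.symm.le))))
  have hx : 0 ≤ x := hι.map_nonneg_iff.1 hx0.le
  have h1 : e ⊓ |x| = 0 := by
    rw [abs_of_nonneg hx]
    apply hι.injective
    rw [hι.map_inf, map_zero]
    exact inf_eq_zero_of_le hu (hι.map_nonneg_iff.2 he.1) hx0.le le_rfl hxu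
  rw [he.2 x h1, map_zero] at hx0
  exact hx0.false

omit [IsOrderedAddMonoid E] in
theorem isLUB_below (hι : IsUniversalCompletion ι) {u : U} (hu : 0 ≤ u) :
    IsLUB (ι '' {x | 0 ≤ x ∧ ι x ≤ u}) u := by
  refine ⟨by rintro _ ⟨x, hx, rfl⟩; exact hx.2, fun v hv => ?_⟩
  by_contra huv
  have hpos : 0 < u - u ⊓ v := lt_of_le_of_ne (sub_nonneg.2 inf_le_left) fun h =>
    huv (inf_eq_left.1 (sub_eq_zero.1 h.symm).symm)
  obtain ⟨x, hx0, hxu⟩ := hι.orderDense _ hpos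
  have hx : 0 ≤ x := hι.map_nonneg_iff.1 hx0.le
  -- If `n • x` lies below `u` it also lies below the upper bound `v`, and the gap `u - u ⊓ v`
  -- leaves room for one more `x`. This contradicts the Archimedean property.
  have key : ∀ n : ℕ, 0 ≤ n • x ∧ ι (n • x) ≤ u := by
    intro n
    induction n with
    | zero => simpa using hu
    | succ k ih =>
      have h0 : 0 ≤ ι (k • x) := hι.map_nonneg_iff.2 ih.1
      have h1 : ι (k • x) ≤ u ⊓ v := le_inf ih.2 (hv ⟨_, ih, rfl⟩)
      have h2 : ι ((k + 1) • x) ≤ u := by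
        rw [succ_nsmul, map_add]
        calc _ ≤ u ⊓ v + (u - u ⊓ v) := add_le_add h1 hxu
          _ = u := by abel
      refine ⟨hι.map_nonneg_iff.1 ?_, h2⟩
      rw [succ_nsmul, map_add]
      exact add_nonneg h0 hx0.le
  have := hι.universallyComplete.1.isArchimedean (ι x) u fun n => by
    rw [← map_nsmul]; exact (key n).2
  exact hx0.not_ge this

end IsUniversalCompletion

end Embedding

/-! ### Conditional expectations respect localization to elements of their range. -/

section ConditionalExpectation

variable {E : Type*} [AddCommGroup E] [Lattice E] [IsOrderedAddMonoid E] [Module ℝ E]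
  {T : E →ₗ[ℝ] E}

omit [Module ℝ E] in
theorem IsWeakOrderUnit.isGLB_posPart (hE : IsArchimedean E) {e y : E}
    (he : IsWeakOrderUnit e) (hy : 0 ≤ y) : IsGLB (Set.range fun k : ℕ => (y - k • e)⁺) 0 := by
  refine ⟨by rintro _ ⟨k, rfl⟩; exact posPart_nonneg _, fun w hw => ?_⟩
  rw [← posPart_eq_zero]
  by_contra h0
  obtain ⟨d, hd, hdw, N, hN⟩ := exists_leOn_bound hE he y
    (lt_of_le_of_ne (posPart_nonneg w) (Ne.symm h0))
  rw [leOn_iff hd.le, abs_of_nonneg hy] at hN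
  have : w⁺ ≤ (y - N • e)⁺ := sup_le (hw ⟨N, rfl⟩) (posPart_nonneg _)
  rw [inf_eq_right.2 (hdw.trans this)] at hN
  exact hd.ne' hN

namespace IsConditionalExpectation

theorem mono (hT : IsConditionalExpectation T) {x y : E} (h : x ≤ y) : T x ≤ T y := by
  rw [← sub_nonneg, ← map_sub]
  exact hT.positive _ (sub_nonneg.2 h)

omit [IsOrderedAddMonoid E] in
theorem mem_R_iff (hT : IsConditionalExpectation T) {x : E} : x ∈ hT.R.toSubmodule ↔ T x = x :=
  ⟨by rintro ⟨y, rfl⟩; exact hT.projection y, fun h => ⟨x, h⟩⟩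

theorem isLUB_image (hT : IsConditionalExpectation T) {A : Set E} {x : E} (hne : A.Nonempty)
    (hdir : DirectedOn (· ≤ ·) A) (hx : IsLUB A x) : IsLUB (T '' A) (T x) := by
  have h := hT.orderContinuous ((fun a => x - a) '' A) (hne.image _) (by
      rintro _ ⟨a, ha, rfl⟩ _ ⟨b, hb, rfl⟩
      obtain ⟨c, hc, hac, hbc⟩ := hdir a ha b hb
      exact ⟨_, ⟨c, hc, rfl⟩, sub_le_sub_left hac x, sub_le_sub_left hbc x⟩) (by
      refine ⟨by rintro _ ⟨a, ha, rfl⟩; exact sub_nonneg.2 (hx.1 ha), fun w hw => ?_⟩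
      have : x ≤ x - w := hx.2 fun a ha => le_sub_comm.1 (hw ⟨a, ha, rfl⟩)
      simpa using this)
  refine ⟨by rintro _ ⟨a, ha, rfl⟩; exact hT.mono (hx.1 ha), fun v hv => ?_⟩
  have : T x - v ≤ 0 := h.2 (by
    rintro _ ⟨_, ⟨a, ha, rfl⟩, rfl⟩
    rw [map_sub]
    exact sub_le_sub_left (hv ⟨a, ha, rfl⟩) _)
  exact sub_nonpos.1 this

/-- A conditional expectation preserves disjointness from elements of its range. -/
theorem map_inf_eq_zero (hT : IsConditionalExpectation T) (hE : IsArchimedean E) {e d y : E}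
    (he : IsWeakOrderUnit e) (hTe : T e = e) (hTd : T d = d) (hd : 0 ≤ d) (hy : 0 ≤ y)
    (hyd : y ⊓ d = 0) : T y ⊓ d = 0 := by
  -- For `a = k • e`, disjointness gives `y ⊓ a ≤ (a - n • d)⁺` for all `n`. The right side lies in
  -- the range, so `T` preserves the bound.
  have htrunc : ∀ k : ℕ, T (y ⊓ k • e) ⊓ d = 0 := by
    intro k
    set a := k • e with ha
    have ha0 : 0 ≤ a := nsmul_nonneg he.1 k
    have hTa : T a = a := by rw [ha, map_nsmul, hTe]
    have h1 : ∀ n : ℕ, T (y ⊓ a) ≤ (a - n • d)⁺ := by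
      intro n
      have hnd : 0 ≤ n • d := nsmul_nonneg hd n
      have hdis : (y ⊓ a) ⊓ (n • d ⊓ a) = 0 := by
        rw [inf_comm] at hyd
        have := nsmul_inf_eq_zero hd hy hyd n
        rw [inf_comm] at this
        exact inf_eq_zero_of_le this (le_inf hy ha0) (le_inf hnd ha0) inf_le_left inf_le_left
      have hle : y ⊓ a ≤ (a - n • d)⁺ := by
        have h3 := inf_add_sup (y ⊓ a) (n • d ⊓ a)
        rw [hdis, zero_add] at h3
        have h4 : (y ⊓ a) + (n • d ⊓ a) ≤ a := h3 ▸ sup_le inf_le_right inf_le_right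
        refine (le_sub_iff_add_le.2 h4).trans (le_of_eq ?_)
        rw [sub_inf, sub_self, posPart_def]
      have hmem : T (a - n • d)⁺ = (a - n • d)⁺ := by
        rw [← hT.mem_R_iff]
        refine hT.R.sup_mem' ?_ (zero_mem hT.R.toSubmodule)
        exact hT.mem_R_iff.2 (by rw [map_sub, hTa, map_nsmul, hTd])
      exact (hT.mono hle).trans hmem.le
    set v := T (y ⊓ a) ⊓ d
    have hv0 : 0 ≤ v := le_inf (hT.positive _ (le_inf hy ha0)) hd
    refine le_antisymm (hE v a fun n => ?_) hv0
    rw [← sub_nonpos, ← posPart_eq_zero]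
    -- The excess `(n • v - a)⁺` lies below both `n • (a - n • d)⁺` and `(a - n • d)⁻`, which are
    -- disjoint. Hence `n • v ≤ a` for every `n`.
    have h2 := nsmul_inf_eq_zero (posPart_nonneg _) (negPart_nonneg _)
      (posPart_inf_negPart_eq_zero (a - n • d)) n
    refine le_antisymm ((le_inf ?_ ?_).trans h2.le) (posPart_nonneg _)
    · exact sup_le ((sub_le_self _ ha0).trans
        (nsmul_le_nsmul_right (inf_le_left.trans (h1 n)) n)) (nsmul_nonneg (posPart_nonneg _) n)
    · rw [← posPart_neg, neg_sub]
      exact posPart_mono (sub_le_sub_right (nsmul_le_nsmul_right inf_le_right n) a)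
  -- The remainders `(y - k • e)⁺` decrease to `0`, and the image of each under `T` dominates `T y ⊓
  -- d` by the truncated case.
  have hglb := hT.orderContinuous _ (Set.range_nonempty _)
    (by
      rintro _ ⟨k, rfl⟩ _ ⟨l, rfl⟩
      refine ⟨_, ⟨max k l, rfl⟩, ?_, ?_⟩ <;>
        exact posPart_mono (sub_le_sub_left (nsmul_le_nsmul_left he.1 (by simp)) y))
    (he.isGLB_posPart hE hy)
  refine le_antisymm (hglb.2 ?_) (le_inf (hT.positive _ hy) hd)
  rintro _ ⟨_, ⟨k, rfl⟩, rfl⟩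
  have hsplit : T y = T (y ⊓ k • e) + T (y - k • e)⁺ := by
    rw [← map_add, posPart_def, ← sub_self y, ← sub_inf, inf_comm, add_sub_cancel]
  have hp : 0 ≤ T (y - k • e)⁺ := hT.positive _ (posPart_nonneg _)
  rw [← sub_nonpos, ← htrunc k]
  refine le_inf (sub_le_iff_le_add.2 (inf_le_left.trans hsplit.le)) ?_
  exact (sub_le_self _ hp).trans inf_le_right

theorem leOn_map (hT : IsConditionalExpectation T) (hE : IsArchimedean E) {e d x y : E}
    (he : IsWeakOrderUnit e) (hTe : T e = e) (hTd : T d = d) (hd : 0 ≤ d) (h : LeOn d x y) :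
    LeOn d (T x) (T y) := by
  obtain ⟨z, hz, hzd, hxy⟩ := h
  refine ⟨T z, hT.positive z hz, hT.map_inf_eq_zero hE he hTe hTd hd hz hzd, ?_⟩
  rw [← map_add]
  exact hT.mono hxy

theorem isWeakOrderUnit_R (hT : IsConditionalExpectation T) {e : E} (he : IsWeakOrderUnit e)
    (hTe : e ∈ hT.R.toSubmodule) : IsWeakOrderUnit (⟨e, hTe⟩ : hT.R.toSubmodule) :=
  ⟨he.1, fun x hx => Subtype.ext (he.2 x (congrArg Subtype.val hx))⟩

theorem isArchimedean_R (hT : IsConditionalExpectation T) (hE : IsArchimedean E) :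
    IsArchimedean hT.R.toSubmodule := fun x y h => hE (x : E) y fun n => h n

end IsConditionalExpectation

theorem RieszSubspace.leOn_coe {K : RieszSubspace E} {d x y : K.toSubmodule} (h : LeOn d x y) :
    LeOn (d : E) x y := by
  obtain ⟨z, hz, hzd, hxy⟩ := h
  exact ⟨z, hz, congrArg Subtype.val hzd, hxy⟩

end ConditionalExpectation

/-! ### Consequences of `E = L¹(T)`: suprema and products. -/

section TUniversallyComplete

variable {E U : Type*}
  [AddCommGroup E] [Lattice E] [IsOrderedAddMonoid E] [Module ℝ E] [IsOrderedModule ℝ E]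
  [AddCommGroup U] [Lattice U] [IsOrderedAddMonoid U] [Module ℝ U] [IsOrderedModule ℝ U]
  {ι : E →ₗ[ℝ] U} {T : E →ₗ[ℝ] E} {e : E} {m : U →ₗ[ℝ] U →ₗ[ℝ] U}

namespace IsTUniversallyComplete

omit [IsOrderedAddMonoid E] [IsOrderedModule ℝ E] [IsOrderedAddMonoid U] [IsOrderedModule ℝ U] in
theorem exists_eq_of_mem (hTE : IsTUniversallyComplete ι T) {u : U}
    (hu : u ∈ naturalDomainPos ι T) : ∃ x, ι x = u := by
  have h0 : (0 : U) ∈ naturalDomainPos ι T := by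
    refine ⟨{0}, Set.singleton_nonempty _, ?_, by simp, ?_, by simp⟩
    · rintro _ rfl _ rfl
      exact ⟨0, rfl, le_rfl, le_rfl⟩
    · exact ⟨ι (T 0), by simp⟩
  have : u ∈ L1 ι T := ⟨u, hu, 0, h0, (sub_zero u).symm⟩
  rwa [hTE.2] at this

omit [IsOrderedModule ℝ E] [IsOrderedModule ℝ U] in
/-- In a `T`-universally complete space, `E` is an ideal of its universal completion. -/
theorem exists_eq_of_le (hTE : IsTUniversallyComplete ι T) (hι : IsUniversalCompletion ι)
    (hT : IsConditionalExpectation T) {u : U} {f : E} (hu : 0 ≤ u) (huf : u ≤ ι f) :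
    ∃ x, ι x = u := by
  refine hTE.exists_eq_of_mem ⟨{x | 0 ≤ x ∧ ι x ≤ u}, ⟨0, by simpa using hu⟩, ?_,
    fun a ha => ha.1, ⟨ι (T f), ?_⟩, hι.isLUB_below hu⟩
  · rintro a ⟨ha0, hau⟩ b ⟨hb0, hbu⟩
    exact ⟨a ⊔ b, ⟨ha0.trans le_sup_left, by rw [hι.map_sup]; exact sup_le hau hbu⟩,
      le_sup_left, le_sup_right⟩
  · rintro _ ⟨a, ⟨-, hau⟩, rfl⟩
    exact hι.map_le_iff.2 (hT.mono (hι.map_le_iff.1 (hau.trans huf)))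

omit [IsOrderedModule ℝ E] [IsOrderedAddMonoid U] [IsOrderedModule ℝ U] in
/-- The range of `T` is closed under positive suprema existing in the universal completion. -/
theorem exists_mem_R_of_isLUB (hTE : IsTUniversallyComplete ι T) (hι : IsUniversalCompletion ι)
    (hT : IsConditionalExpectation T) {S : Set U} {u : U} (hu : 0 ≤ u) (hS : IsLUB S u)
    (hSR : ∀ s ∈ S, ∃ x ∈ hT.R.toSubmodule, ι x = s) : ∃ x ∈ hT.R.toSubmodule, ι x = u := by
  -- `A` replaces `S` by a directed set of positive elements with the same supremum. `T` fixes `A`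
  -- pointwise, so `u` itself bounds the image.
  set A : Set E := {a | 0 ≤ a ∧ T a = a ∧ ι a ≤ u}
  have hne : A.Nonempty := ⟨0, le_rfl, map_zero T, by simpa using hu⟩
  have hsup : ∀ a b, T a = a → T b = b → T (a ⊔ b) = a ⊔ b := fun a b ha hb =>
    hT.mem_R_iff.1 (hT.R.sup_mem' (hT.mem_R_iff.2 ha) (hT.mem_R_iff.2 hb))
  have hdir : DirectedOn (· ≤ ·) A := by
    rintro a ⟨ha0, haT, hau⟩ b ⟨hb0, hbT, hbu⟩
    exact ⟨a ⊔ b, ⟨ha0.trans le_sup_left, hsup a b haT hbT,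
      by rw [hι.map_sup]; exact sup_le hau hbu⟩, le_sup_left, le_sup_right⟩
  have hlub : IsLUB (ι '' A) u := by
    refine ⟨by rintro _ ⟨a, ha, rfl⟩; exact ha.2.2, fun v hv => hS.2 fun s hs => ?_⟩
    obtain ⟨x, hx, rfl⟩ := hSR s hs
    refine (hι.map_le_iff.2 le_sup_left).trans (hv ⟨x ⊔ 0, ⟨le_sup_right,
      hsup x 0 (hT.mem_R_iff.1 hx) (map_zero T), ?_⟩, rfl⟩)
    rw [hι.map_sup, map_zero]
    exact sup_le (hS.1 hs) hu
  obtain ⟨x, rfl⟩ := hTE.exists_eq_of_mem ⟨A, hne, hdir, fun a ha => ha.1,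
    ⟨u, by rintro _ ⟨a, ha, rfl⟩; simpa only [ha.2.1] using ha.2.2⟩, hlub⟩
  have hlubE : IsLUB A x :=
    ⟨fun a ha => hι.map_le_iff.1 (hlub.1 ⟨a, ha, rfl⟩), fun v hv => hι.map_le_iff.1
      (hlub.2 (by rintro _ ⟨a, ha, rfl⟩; exact hι.map_le_iff.2 (hv ha)))⟩
  have hTx := hT.isLUB_image hne hdir hlubE
  have hTA : T '' A = A := by
    ext a
    exact ⟨by rintro ⟨b, hb, rfl⟩; rwa [hb.2.1], fun ha => ⟨a, ha, ha.2.1⟩⟩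
  rw [hTA] at hTx
  exact ⟨x, hT.mem_R_iff.2 (hTx.unique hlubE), rfl⟩

omit [IsOrderedModule ℝ E] [IsOrderedModule ℝ U] in
theorem isUniversallyComplete_R (hTE : IsTUniversallyComplete ι T)
    (hι : IsUniversalCompletion ι) (hT : IsConditionalExpectation T) :
    IsUniversallyComplete hT.R.toSubmodule := by
  refine ⟨hT.range_dedekindComplete, fun S hne hS => ?_⟩
  -- The supremum is built from positive parts, which would be wrong for a single negative element.
  -- With two disjoint elements every upper bound is automatically nonnegative.
  rcases hne.exists_eq_singleton_or_nontrivial with ⟨s, rfl⟩ | hnt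
  · exact ⟨s, isLUB_singleton⟩
  have habs : ∀ x : hT.R.toSubmodule, |ι (x : E) ⊔ 0| ≤ ι (|x| : hT.R.toSubmodule) := fun x => by
    rw [abs_of_nonneg le_sup_right]
    have h : ι (|x| : hT.R.toSubmodule) = |ι (x : E)| := hι.map_abs x
    rw [h]
    exact sup_le (le_abs_self _) (abs_nonneg _)
  obtain ⟨u, hu⟩ := hι.universallyComplete.2 ((fun x : hT.R.toSubmodule => ι (x : E) ⊔ 0) '' S)
    (hne.image _) (by
      rintro _ ⟨x, hx, rfl⟩ _ ⟨y, hy, rfl⟩ hxy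
      have h : |x| ⊓ |y| = 0 := hS hx hy fun h => hxy (h ▸ rfl)
      have h' : ι (|x| : hT.R.toSubmodule) ⊓ ι (|y| : hT.R.toSubmodule) = 0 := by
        rw [← hι.map_inf, ← map_zero ι]
        exact congrArg (fun z : hT.R.toSubmodule => ι (z : E)) h
      exact inf_eq_zero_of_le h' (abs_nonneg _) (abs_nonneg _) (habs x) (habs y))
  obtain ⟨s, hs⟩ := hne
  have hu0 : 0 ≤ u := le_sup_right.trans (hu.1 ⟨s, hs, rfl⟩)
  obtain ⟨x, hx, rfl⟩ := hTE.exists_mem_R_of_isLUB hι hT hu0 hu (by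
    rintro _ ⟨y, hy, rfl⟩
    exact ⟨y ⊔ 0, hT.R.sup_mem' y.2 (zero_mem hT.R.toSubmodule), by rw [hι.map_sup, map_zero]⟩)
  refine ⟨⟨x, hx⟩, fun y hy => ?_, fun v hv => ?_⟩
  · exact hι.map_le_iff.1 (le_sup_left.trans (hu.1 ⟨y, hy, rfl⟩))
  · have hv0 : 0 ≤ v := by
      obtain ⟨a, ha, b, hb, hab⟩ := hnt
      have h : |a| ⊓ |b| = 0 := hS ha hb hab
      have h1 : -v ≤ |a| ⊓ |b| :=
        le_inf ((neg_le_neg (hv ha)).trans (neg_le_abs a)) ((neg_le_neg (hv hb)).trans (neg_le_abs b))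
      rw [h] at h1
      exact neg_nonpos.1 h1
    refine hι.map_le_iff.1 (hu.2 ?_)
    rintro _ ⟨y, hy, rfl⟩
    exact sup_le (hι.map_le_iff.2 (hv hy)) (hι.map_nonneg_iff.2 hv0)

omit [IsOrderedModule ℝ E] in
/-- The range of `T` is closed under products of the universal completion. -/
theorem exists_mem_R_mul (hTE : IsTUniversallyComplete ι T) (hι : IsUniversalCompletion ι)
    (hT : IsConditionalExpectation T) (he : IsWeakOrderUnit e) (hTe : T e = e)
    (hm : IsFAlgebraProduct m (ι e)) (g h : hT.R.toSubmodule) :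
    ∃ k : hT.R.toSubmodule, ι k = m (ι g) (ι h) := by
  have he' := hι.map_isWeakOrderUnit he
  have hA := hι.universallyComplete.1.isArchimedean
  obtain ⟨q, hq, m', hm'q, hval⟩ := exists_product_hasVal hι.universallyComplete he'
  -- By uniqueness the given product is the polarized one, so it suffices that squares, which are
  -- suprema of elements of `R(T)`, stay in `R(T)`.
  obtain rfl := IsFAlgebraProduct.eq_of_hasVal hA he' hm (isFAlgebraProduct_of_hasVal hA he' hval)
  have hsq : ∀ g ∈ hT.R.toSubmodule, ∃ x ∈ hT.R.toSubmodule, ι x = q (ι g) := by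
    intro g hg
    refine hTE.exists_mem_R_of_isLUB hι hT ((hq (ι g)).1 ⟨0, by simp⟩) (hq (ι g)) ?_
    rintro _ ⟨t, rfl⟩
    exact ⟨(2 * t) • g - t ^ 2 • e, sub_mem (Submodule.smul_mem _ _ hg)
      (Submodule.smul_mem _ _ (hT.mem_R_iff.2 hTe)), by simp⟩
  obtain ⟨x, hx, hxq⟩ := hsq _ (add_mem g.2 h.2)
  obtain ⟨y, hy, hyq⟩ := hsq _ (sub_mem g.2 h.2)
  refine ⟨⟨(4⁻¹ : ℝ) • (x - y), Submodule.smul_mem _ _ (sub_mem hx hy)⟩, ?_⟩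
  rw [hm'q, ← map_add, ← map_sub, ← hxq, ← hyq, ← map_sub, ← map_smul]

omit [IsOrderedModule ℝ U] in
/-- The averaging inequality `T (h f) ≤ h (T f)`. -/
theorem map_mul_le (hι : IsUniversalCompletion ι)
    (hT : IsConditionalExpectation T) (hE : IsArchimedean E) (he : IsWeakOrderUnit e)
    (hTe : T e = e) (hm : IsFAlgebraProduct m (ι e)) {h b : hT.R.toSubmodule} {f a : E}
    (hf : 0 ≤ f) (ha : ι a = m (ι h) (ι f)) (hb : ι b = m (ι h) (ι (T f))) : T a ≤ b := by
  set x : hT.R.toSubmodule := ⟨T a, ⟨a, rfl⟩⟩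
  set y : hT.R.toSubmodule := ⟨T f, ⟨f, rfl⟩⟩
  set e₁ : hT.R.toSubmodule := ⟨e, ⟨e, hTe⟩⟩
  have he₁ : IsWeakOrderUnit e₁ := hT.isWeakOrderUnit_R he ⟨e, hTe⟩
  have hR := hT.isArchimedean_R hE
  have hTf := hT.positive f hf
  by_contra hab
  -- The localization is carried out inside `R(T)`, so that the localizing elements are fixed by `T`
  -- and `leOn_map` applies.
  obtain ⟨d₀, hd₀, ε, hε, h0⟩ := exists_leOn_of_not_le (x := x) (y := b) hR he₁.1 hab
  obtain ⟨d₁, hd₁, hd₁₀, N, hN⟩ := exists_leOn_bound hR he₁ y hd₀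
  have hN1 : (0 : ℝ) < N + 1 := by positivity
  set δ : ℝ := ε / (N + 1) with hδ
  have hδ0 : 0 < δ := div_pos hε hN1
  obtain ⟨d, hd, hd₂₁, r, h1, h2⟩ := exists_leOn_approx hR he₁ h hd₁ hδ0
  have hdE : (0 : E) ≤ d := hd.le
  have hdU : 0 ≤ ι d := hι.map_nonneg_iff.2 hdE
  have hTd : T d = d := hT.mem_R_iff.1 d.2
  have k0 : LeOn (d : E) (b + ε • e) (T a) :=
    RieszSubspace.leOn_coe (h0.mono hd.le (hd₂₁.trans hd₁₀))
  have k1 : LeOn (d : E) (T f) ((N : ℝ) • e) := by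
    have h3 : LeOn (d : E) |T f| (N • e) := RieszSubspace.leOn_coe (hN.mono hd.le hd₂₁)
    rwa [abs_of_nonneg hTf, ← Nat.cast_smul_eq_nsmul ℝ] at h3
  have k2 : LeOn (d : E) a ((r + δ) • f) := by
    have h3 : LeOn (d : E) h ((r + δ) • e) := RieszSubspace.leOn_coe h2
    have h4 := hm.leOn_mul_right hdU ((hι.map_leOn_iff hdE).2 h3) (hι.map_nonneg_iff.2 hf)
    rwa [← ha, map_smul, map_smul, LinearMap.smul_apply, hm.one_mul, ← map_smul,
      hι.map_leOn_iff hdE] at h4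
  have k3 : LeOn (d : E) (r • T f) b := by
    have h3 : LeOn (d : E) (r • e) h := RieszSubspace.leOn_coe h1
    have h4 := hm.leOn_mul_right hdU ((hι.map_leOn_iff hdE).2 h3) (hι.map_nonneg_iff.2 hTf)
    rwa [← hb, map_smul, map_smul, LinearMap.smul_apply, hm.one_mul, ← map_smul,
      hι.map_leOn_iff hdE] at h4
  -- On `d` this yields `b + εe ≤ T a ≤ (r + δ) T f ≤ b + δNe`, impossible because `δN < ε`.
  have k4 := hT.leOn_map hE he hTe hTd hdE k2
  rw [map_smul, add_smul] at k4
  have k5 := (k0.trans hdE k4).trans hdE (k3.add hdE (k1.smul hdE hδ0.le))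
  have k6 := k5.add hdE (LeOn.of_le hdE (le_refl (-(b : E))))
  refine LeOn.not_smul_lt he (d := (d : E)) hd (r := ε) (s := δ * N) ?_ ?_
  · rw [hδ, div_mul_eq_mul_div, div_lt_iff₀ hN1]
    linarith
  · rw [smul_smul] at k6
    convert k6 using 1 <;> abel

/-- `E = L¹(T)` is closed under multiplication by elements of the range of `T`. -/
theorem exists_eq_mul (hTE : IsTUniversallyComplete ι T) (hι : IsUniversalCompletion ι)
    (hT : IsConditionalExpectation T) (hE : IsArchimedean E) (he : IsWeakOrderUnit e)
    (hTe : T e = e) (hm : IsFAlgebraProduct m (ι e)) (g : hT.R.toSubmodule) (f : E) :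
    ∃ x, ι x = m (ι g) (ι f) := by
  have he' := hι.map_isWeakOrderUnit he
  have hA := hι.universallyComplete.1.isArchimedean
  have key : ∀ g : hT.R.toSubmodule, 0 ≤ g → ∀ f : E, 0 ≤ f → ∃ x, ι x = m (ι g) (ι f) := by
    intro g hg f hf
    set e₁ : hT.R.toSubmodule := ⟨e, ⟨e, hTe⟩⟩
    have hgE : (0 : E) ≤ g := hg
    have hgU : 0 ≤ ι g := hι.map_nonneg_iff.2 hgE
    have hfU : 0 ≤ ι f := hι.map_nonneg_iff.2 hf
    have hTfU : 0 ≤ ι (T f) := hι.map_nonneg_iff.2 (hT.positive f hf)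
    have hcut : ∀ n : ℕ, ι (g ⊓ n • e₁ : hT.R.toSubmodule) = ι g ⊓ n • ι e := fun n => by
      rw [← map_nsmul, ← hι.map_inf]; rfl
    have hcut0 : ∀ n : ℕ, 0 ≤ ι g ⊓ n • ι e := fun n => le_inf hgU (nsmul_nonneg he'.1 n)
    -- The truncated product is dominated by `n • f`, and `E` is an ideal of `U`.
    have hex : ∀ n : ℕ, ∃ a, ι a = m (ι g ⊓ n • ι e) (ι f) := fun n => by
      refine hTE.exists_eq_of_le hι hT (f := n • f) (hm.nonneg _ _ (hcut0 n) hfU) ?_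
      calc _ ≤ m (n • ι e) (ι f) := hm.mono (hcut0 n) inf_le_right hfU le_rfl
        _ = ι (n • f) := by rw [map_nsmul, LinearMap.smul_apply, hm.one_mul, map_nsmul]
    choose a ha using hex
    have hmono : Monotone a := fun k l hkl => hι.map_le_iff.1 (by
      rw [ha, ha]
      exact hm.mono (hcut0 k) (inf_le_inf_left _ (nsmul_le_nsmul_left he'.1 hkl)) hfU le_rfl)
    refine hTE.exists_eq_of_mem ⟨Set.range a, Set.range_nonempty a,
      directedOn_range.2 hmono.directed_le, ?_, ⟨m (ι g) (ι (T f)), ?_⟩, ?_⟩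
    · rintro _ ⟨n, rfl⟩
      exact hι.map_nonneg_iff.1 (by rw [ha]; exact hm.nonneg _ _ (hcut0 n) hfU)
    -- The bound `g T(f)` need only exist in `U`, which is all the natural domain requires.
    · rintro _ ⟨_, ⟨n, rfl⟩, rfl⟩
      obtain ⟨b, hb⟩ := hTE.exists_mem_R_mul hι hT he hTe hm (g ⊓ n • e₁) ⟨T f, ⟨f, rfl⟩⟩
      refine (hι.map_le_iff.2 (map_mul_le hι hT hE he hTe hm hf
        ((ha n).trans (by rw [hcut])) hb)).trans ?_
      rw [hb, hcut]
      exact hm.mono (hcut0 n) inf_le_left hTfU le_rfl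
    · have := hm.isLUB_truncations hA he' hgU hfU
      rwa [← Set.range_comp, show ⇑ι ∘ a = fun n : ℕ => m (ι g ⊓ n • ι e) (ι f) from funext ha]
  have key' : ∀ g : hT.R.toSubmodule, 0 ≤ g → ∀ f : E, ∃ x, ι x = m (ι g) (ι f) := by
    intro g hg f
    obtain ⟨x, hx⟩ := key g hg f⁺ (posPart_nonneg f)
    obtain ⟨y, hy⟩ := key g hg f⁻ (negPart_nonneg f)
    exact ⟨x - y, by rw [map_sub, hx, hy, ← map_sub, ← map_sub, posPart_sub_negPart]⟩
  obtain ⟨x, hx⟩ := key' g⁺ (posPart_nonneg g) f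
  obtain ⟨y, hy⟩ := key' g⁻ (negPart_nonneg g) f
  refine ⟨x - y, ?_⟩
  rw [map_sub, hx, hy, ← LinearMap.sub_apply, ← map_sub, ← map_sub, ← Submodule.coe_sub,
    posPart_sub_negPart]

/-- If `|f| ≤ h` with `h` in `R(T)`, then `|gf| ≤ |g| h`, and `|g| h` lies in `R(T)`. -/
theorem exists_mem_LInfty_mul (hTE : IsTUniversallyComplete ι T) (hι : IsUniversalCompletion ι)
    (hT : IsConditionalExpectation T) (hE : IsArchimedean E) (he : IsWeakOrderUnit e)
    (hTe : T e = e) (hm : IsFAlgebraProduct m (ι e)) (g : hT.R.toSubmodule) (f : LInfty hT) :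
    ∃ x : LInfty hT, ι x = m (ι g) (ι f) := by
  obtain ⟨x, hx⟩ := hTE.exists_eq_mul hι hT hE he hTe hm g f
  obtain ⟨h, hh, hh0, hfh⟩ := f.2
  obtain ⟨k, hk⟩ := hTE.exists_mem_R_mul hι hT he hTe hm |g| ⟨h, hh⟩
  have habs : ι (|g| : hT.R.toSubmodule) = |ι (g : E)| := hι.map_abs g
  have hxk : |x| ≤ k := by
    rw [← hι.map_le_iff, hι.map_abs, hx, hk, habs]
    refine (hm.abs_le hι.universallyComplete.1.isArchimedean (hι.map_isWeakOrderUnit he) _ _).trans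
      (hm.mono (abs_nonneg _) le_rfl (abs_nonneg _) ?_)
    rw [← hι.map_abs]
    exact hι.map_le_iff.2 hfh
  exact ⟨⟨x, k, k.2, (abs_nonneg x).trans hxk, hxk⟩, hx⟩

end IsTUniversallyComplete

end TUniversallyComplete
end RieszCE

theorem theorem2p2 {E U : Type*}
    [AddCommGroup E] [Lattice E] [IsOrderedAddMonoid E] [Module ℝ E] [IsOrderedModule ℝ E]
    [AddCommGroup U] [Lattice U] [IsOrderedAddMonoid U] [Module ℝ U] [IsOrderedModule ℝ U]
    (hE : RieszCE.IsDedekindComplete E)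
    (ι : E →ₗ[ℝ] U) (hι : RieszCE.IsUniversalCompletion ι)
    (T : E →ₗ[ℝ] E) (hT : RieszCE.IsConditionalExpectation T)
    (hTE : RieszCE.IsTUniversallyComplete ι T)
    (e : E) (he : RieszCE.IsWeakOrderUnit e) (hTe : T e = e) :
    -- `R(T)` is universally complete
    RieszCE.IsUniversallyComplete hT.R.toSubmodule ∧
    -- the universal completion is an `f`-algebra with unit `e`
    (∃ m : U →ₗ[ℝ] U →ₗ[ℝ] U, RieszCE.IsFAlgebraProduct m (ι e)) ∧
    -- and its product restricts as follows
    (∀ m : U →ₗ[ℝ] U →ₗ[ℝ] U, RieszCE.IsFAlgebraProduct m (ι e) →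
      -- `R(T)` is an `f`-algebra with unit `e`
      ∃ mR : hT.R.toSubmodule →ₗ[ℝ] hT.R.toSubmodule →ₗ[ℝ] hT.R.toSubmodule,
        RieszCE.IsFAlgebraProduct mR ⟨e, ⟨e, hTe⟩⟩ ∧
        (∀ g h : hT.R.toSubmodule, ι (mR g h : E) = m (ι g) (ι h)) ∧
        -- `E = L¹(T)` is an `R(T)`-module
        (∃ act : hT.R.toSubmodule →ₗ[ℝ] E →ₗ[ℝ] E,
          RieszCE.IsModuleAction mR ⟨e, ⟨e, hTe⟩⟩ act ∧
          ∀ (g : hT.R.toSubmodule) (f : E), ι (act g f) = m (ι g) (ι f)) ∧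
        -- `L^∞(T)` is an `R(T)`-module
        (∃ act : hT.R.toSubmodule →ₗ[ℝ] RieszCE.LInfty hT →ₗ[ℝ] RieszCE.LInfty hT,
          RieszCE.IsModuleAction mR ⟨e, ⟨e, hTe⟩⟩ act ∧
          ∀ (g : hT.R.toSubmodule) (f : RieszCE.LInfty hT),
            ι (act g f : E) = m (ι g) (ι f))) := by
  have hA := hι.universallyComplete.1.isArchimedean
  have he' := hι.map_isWeakOrderUnit he
  refine ⟨hTE.isUniversallyComplete_R hι hT, ?_, fun m hm => ?_⟩
  · obtain ⟨q, -, m, -, hval⟩ := RieszCE.exists_product_hasVal hι.universallyComplete he'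
    exact ⟨m, RieszCE.isFAlgebraProduct_of_hasVal hA he' hval⟩
  have hinj : Function.Injective (ι ∘ₗ hT.R.toSubmodule.subtype) :=
    hι.injective.comp Subtype.val_injective
  have hEA := hE.isArchimedean
  -- The three products are corestrictions of `m`; the algebra and module laws are inherited from
  -- `U` by injectivity of the embeddings.
  obtain ⟨mR, hmR⟩ := RieszCE.exists_bilinear_restrict m (ι ∘ₗ hT.R.toSubmodule.subtype)
    (ι ∘ₗ hT.R.toSubmodule.subtype) (ι ∘ₗ hT.R.toSubmodule.subtype) hinj
    (hTE.exists_mem_R_mul hι hT he hTe hm)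
  have hmR' : ∀ g h : hT.R.toSubmodule, ι (mR g h : E) = m (ι g) (ι h) := hmR
  obtain ⟨act₁, h₁⟩ := RieszCE.exists_bilinear_restrict m (ι ∘ₗ hT.R.toSubmodule.subtype) ι ι
    hι.injective (hTE.exists_eq_mul hι hT hEA he hTe hm)
  have h₁' : ∀ (g : hT.R.toSubmodule) (f : E), ι (act₁ g f) = m (ι g) (ι f) := h₁
  obtain ⟨act₂, h₂⟩ := RieszCE.exists_bilinear_restrict m (ι ∘ₗ hT.R.toSubmodule.subtype)
    (ι ∘ₗ (RieszCE.LInfty hT).subtype) (ι ∘ₗ (RieszCE.LInfty hT).subtype)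
    (hι.injective.comp Subtype.val_injective) (hTE.exists_mem_LInfty_mul hι hT hEA he hTe hm)
  have h₂' : ∀ (g : hT.R.toSubmodule) (f : RieszCE.LInfty hT),
      ι (act₂ g f : E) = m (ι g) (ι f) := h₂
  have hinf : ∀ a b : hT.R.toSubmodule, a ⊓ b = 0 ↔ ι (a : E) ⊓ ι (b : E) = 0 := fun a b => by
    rw [← hι.map_inf, ← map_zero ι, hι.injective.eq_iff]
    exact ⟨fun h => congrArg Subtype.val h, fun h => Subtype.ext h⟩
  have hnn : ∀ a : hT.R.toSubmodule, 0 ≤ a ↔ 0 ≤ ι (a : E) := fun a => hι.map_nonneg_iff.symm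
  refine ⟨mR, ⟨?_, ?_, ?_, ?_, ?_, ?_⟩, hmR', ⟨act₁, ⟨?_, ?_⟩, h₁'⟩, ⟨act₂, ⟨?_, ?_⟩, h₂'⟩⟩
  · intro a b c
    refine Subtype.ext (hι.injective ?_)
    rw [hmR', hmR', hmR', hmR', hm.assoc]
  · intro a
    refine Subtype.ext (hι.injective ?_)
    rw [hmR', hm.one_mul]
  · intro a
    refine Subtype.ext (hι.injective ?_)
    rw [hmR', hm.mul_one]
  · intro a b ha hb
    rw [hnn] at ha hb ⊢
    rw [hmR']
    exact hm.nonneg _ _ ha hb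
  · intro a b c hab hc
    rw [hnn] at hc
    rw [hinf] at hab ⊢
    rw [hmR']
    exact hm.disjoint_left _ _ _ hab hc
  · intro a b c hab hc
    rw [hnn] at hc
    rw [hinf] at hab ⊢
    rw [hmR']
    exact hm.disjoint_right _ _ _ hab hc
  · intro f
    apply hι.injective
    rw [h₁', hm.one_mul]
  · intro a b f
    apply hι.injective
    rw [h₁', h₁', h₁', hmR', hm.assoc]
  · intro f
    refine Subtype.ext (hι.injective ?_)
    rw [h₂', hm.one_mul]
  · intro a b f
    refine Subtype.ext (hι.injective ?_)
    rw [h₂', h₂', h₂', hmR', hm.assoc]
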